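/- Let $\Omega=(0,1)^2\subset\mathbb R^2$, $0<\alpha<1$, $a>0$. For $\epsilon>0$ put $h_\epsilon(x_1,x_2)=\bigl(x_1,\;x_2+x_2\,\epsilon\sin(x_1/\epsilon^{\alpha})\bigr)$, $\Omega_\epsilon=h_\epsilon(\Omega)$, let $Jh_\epsilon=1+\epsilon\sin(x_1/\epsilon^\alpha)$ be the Jacobian determinant of $h_\epsilon$ and let $J_{\partial\Omega}h_\epsilon$ be the tangential Jacobian of $h_\epsilon:\partial\Omega\to\partial\Omega_\epsilon$ (defined off the corners). Write $\gamma$ for the trace operator on $H^1$, and $h_\epsilon^*\nabla_{\Omega_\epsilon}h_\epsilon^{*-1}u=(\nabla(u\circ h_\epsilon^{-1}))\circ h_\epsilon$ for the pulled-back gradient. Let $f\in C^1(\mathbb R,\mathbb R)$ and $g\in C^2(\mathbb R,\mathbb R)$ satisfy the following conditions. * (Growth) There are $\lambda_1,L_1,\lambda_2,L_2>0$ such that for all $s,t\in\mathbb R$: $|f(s)-f(t)|\le L_1(1+|s|^{\lambda_1}+|t|^{\lambda_1})|s-t|$ and $|g(s)-g(t)|\le L_2(1+|s|^{\lambda_2}+|t|^{\lambda_2})|s-t|$.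 * (Dissipativity) There are real numbers $c_0,d_0,d_0'$ with $d_0>d_0'$, $\limsup_{|s|\to\infty}f(s)/s\le c_0$ and $\limsup_{|s|\to\infty}g(s)/s\le d_0'$, such that the first (smallest) eigenvalue $\mu_1$ of the Robin problem $-\Delta u+(a-c_0)u=\mu u$ in $\Omega$, $\partial u/\partial N=d_0u$ on $\partial\Omega$ (in the weak sense) is positive. Let $\mathcal E_\epsilon$ be the set of weak solutions $v\in H^1(\Omega_\epsilon)$ of $\Delta v-av+f(v)=0$ in $\Omega_\epsilon$, $\partial v/\partial N=g(v)$ on $\partial\Omega_\epsilon$, that is, of $$\int_{\Omega_\epsilon}\nabla v\cdot\nabla\Psi\,dy+a\int_{\Omega_\epsilon}v\Psi\,dy=\int_{\Omega_\epsilon}f(v)\Psi\,dy+\int_{\partial\Omega_\epsilon}g(\gamma(v))\gamma(\Psi)\,d\sigma\qquad\text{for all }\Psi\in H^1(\Omega_\epsilon).$$ Let $E_\epsilon$ be the set of equilibria of the pulled-back problem $u_t+A_\epsilon u=F(u)+G_\epsilon(u)$ on $\Omega$, that is, of the $u\in H^1(\Omega)$ with $A_\epsilon u=F(u)+G_\epsilon(u)$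 in $H^{-1}(\Omega)=(H^1(\Omega))'$, where for $\psi\in H^1(\Omega)$ $$\langle A_\epsilon u,\psi\rangle=\int_\Omega(h_\epsilon^*\nabla_{\Omega_\epsilon}h_\epsilon^{*-1}u)\cdot\Bigl(h_\epsilon^*\nabla_{\Omega_\epsilon}h_\epsilon^{*-1}\frac{\psi}{|Jh_\epsilon|}\Bigr)|Jh_\epsilon|\,dx+a\int_\Omega u\psi\,dx,$$ $$\langle F(u),\psi\rangle=\int_\Omega f(u)\psi\,dx,\qquad \langle G_\epsilon(u),\psi\rangle=\int_{\partial\Omega}g(\gamma(u))\gamma(\psi)\Bigl|\frac{J_{\partial\Omega}h_\epsilon}{Jh_\epsilon}\Bigr|\,d\sigma.$$ Then there are $\epsilon_0>0$ and $R\in\mathbb R$ such that, for every $\epsilon\in(0,\epsilon_0)$, $$\|v\|_{H^1(\Omega_\epsilon)}\le R\ \text{ for all }v\in\mathcal E_\epsilon\qquad\text{and}\qquad\|u\|_{H^1(\Omega)}\le R\ \text{ for all }u\in E_\epsilon .$$ -/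

import Mathlib

noncomputable section

namespace OscillatingSquare

open scoped ContDiff
open MeasureTheory Filter Topology

/-- The Euclidean plane. -/
abbrev Plane : Type := EuclideanSpace ℝ (Fin 2)

/-! ### First order Sobolev spaces on open subsets of the plane -/

/-- `G` is the weak gradient of `u` in `Ω`: both are locally integrable in `Ω` and
`∫ u ∂ᵥφ = - ∫ (G · v) φ` for every direction `v` and every `φ ∈ C_c^∞(Ω)`. -/
def HasWeakGrad (Ω : Set Plane) (u : Plane → ℝ) (G : Plane → Plane) : Prop :=
  LocallyIntegrableOn u Ω volume ∧ LocallyIntegrableOn G Ω volume ∧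
    ∀ φ : Plane → ℝ, ContDiff ℝ ∞ φ → HasCompactSupport φ → tsupport φ ⊆ Ω →
      ∀ v : Plane, ∫ x in Ω, u x * fderiv ℝ φ x v = - ∫ x in Ω, inner ℝ (G x) v * φ x

/-- `u ∈ H¹(Ω)`. -/
def MemH1 (Ω : Set Plane) (u : Plane → ℝ) : Prop :=
  MemLp u 2 (volume.restrict Ω) ∧
    ∃ G : Plane → Plane, MemLp G 2 (volume.restrict Ω) ∧ HasWeakGrad Ω u G

open Classical in
/-- The weak gradient (determined almost everywhere in `Ω`); zero if there is none. -/
def weakGrad (Ω : Set Plane) (u : Plane → ℝ) : Plane → Plane :=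
  if h : ∃ G : Plane → Plane, HasWeakGrad Ω u G then h.choose else 0

/-- The norm of `H¹(Ω)`. -/
def h1Norm (Ω : Set Plane) (u : Plane → ℝ) : ℝ :=
  Real.sqrt ((∫ x in Ω, u x ^ 2) + ∫ x in Ω, ‖weakGrad Ω u x‖ ^ 2)

/-- `w` is the trace of `u ∈ H¹(Ω)` in `L²(∂Ω, σ)`: the pair `(u, w)` is a limit, in
`H¹(Ω) × L²(∂Ω, σ)`, of pairs `(φ|_Ω, φ|_{∂Ω})` with `φ` smooth up to the boundary
(`w` is determined up to equality `σ`-almost everywhere on the domains used below). -/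
def IsTrace (Ω : Set Plane) (σ : Measure Plane) (u w : Plane → ℝ) : Prop :=
  MemH1 Ω u ∧ MemLp w 2 σ ∧
    ∃ φ : ℕ → Plane → ℝ, (∀ n, ContDiff ℝ ∞ (φ n)) ∧
      Tendsto (fun n => h1Norm Ω (fun x => φ n x - u x)) atTop (𝓝 0) ∧
      Tendsto (fun n => eLpNorm (fun x => φ n x - w x) 2 σ) atTop (𝓝 0)

/-! ### The square, the maps `h_ε` and the perturbed domains -/

/-- The open unit square `Ω`. -/
def square : Set Plane := {x | 0 < x 0 ∧ x 0 < 1 ∧ 0 < x 1 ∧ x 1 < 1}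

/-- `h_ε(x₁, x₂) = (x₁, x₂ + x₂ ε sin(x₁ / ε^α))`. -/
def hMap (α ε : ℝ) (x : Plane) : Plane :=
  !₂[x 0, x 1 + x 1 * ε * Real.sin (x 0 / ε ^ α)]

/-- The perturbed domain `Ω_ε = h_ε(Ω)`. -/
def perturbedDomain (α ε : ℝ) : Set Plane := hMap α ε '' square

/-- The four sides of the unit square, each parametrized by `[0, 1]`. -/
def side : Fin 4 → ℝ → Plane :=
  ![fun s => !₂[s, 0], fun s => !₂[s, 1], fun s => !₂[0, s], fun s => !₂[1, s]]

/-- The arc length measure of the curve `c : [0, 1] → ℝ²`. -/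
def arcMeasure (c : ℝ → Plane) : Measure Plane :=
  ((volume.restrict (Set.Icc (0 : ℝ) 1)).withDensity
    (fun s => ENNReal.ofReal ‖deriv c s‖)).map c

/-- The length measure `dσ` on `∂Ω`. -/
def squareBdry : Measure Plane := ∑ i, arcMeasure (side i)

/-- The length measure `dσ` on `∂Ω_ε`, the union of the images under `h_ε` of the four sides. -/
def perturbedBdry (α ε : ℝ) : Measure Plane := ∑ i, arcMeasure (hMap α ε ∘ side i)

/-- The Jacobian determinant `J h_ε`. -/
def jac (α ε : ℝ) (x : Plane) : ℝ := 1 + ε * Real.sin (x 0 / ε ^ α)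

/-- The Jacobian determinant `J_{∂Ω} h_ε` of `h_ε : ∂Ω → ∂Ω_ε` (length of the image under
`D h_ε` of the unit tangent; defined off the four corners): the unit tangent is `(1, 0)` on the
horizontal sides and `(0, 1)` on the vertical ones. -/
def bdryJac (α ε : ℝ) (x : Plane) : ℝ :=
  if x 1 = 0 ∨ x 1 = 1 then
    Real.sqrt (1 + (x 1 * ε ^ (1 - α) * Real.cos (x 0 / ε ^ α)) ^ 2)
  else |jac α ε x|

/-- The entry `b₁₂` of the inverse transpose of the Jacobian matrix of `h_ε`; the other ones
are `b₁₁ = 1`, `b₂₁ = 0` and `b₂₂ = 1 / J h_ε`. -/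
def b12 (α ε : ℝ) (x : Plane) : ℝ :=
  -(x 1 * ε ^ (1 - α) * Real.cos (x 0 / ε ^ α)) / jac α ε x

/-- The pulled-back gradient `h_ε^* ∇_{Ω_ε} h_ε^{*-1} u`, with components `∑ⱼ bᵢⱼ ∂ⱼ u`. -/
def pullGrad (α ε : ℝ) (u : Plane → ℝ) (x : Plane) : Plane :=
  !₂[weakGrad square u x 0 + b12 α ε x * weakGrad square u x 1,
     (1 / jac α ε x) * weakGrad square u x 1]

/-! ### The pulled-back problem on the square and its equilibria -/

/-- `⟨A_ε u, ψ⟩_{-1,1}` for the operator `A_ε = - h_ε^* Δ_{Ω_ε} h_ε^{*-1} + a I` with domain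
`H¹(Ω)` and values in `H^{-1}(Ω)`. -/
def opA (α ε a : ℝ) (u ψ : Plane → ℝ) : ℝ :=
  (∫ x in square, inner ℝ (pullGrad α ε u x)
      (pullGrad α ε (fun y => ψ y / |jac α ε y|) x) * |jac α ε x|) +
    a * ∫ x in square, u x * ψ x

/-- `⟨F(u), ψ⟩`. -/
def opF (f : ℝ → ℝ) (u ψ : Plane → ℝ) : ℝ := ∫ x in square, f (u x) * ψ x

/-- `⟨G_ε(u), ψ⟩`, where `w = γ(u)` and `χ = γ(ψ)` are the traces. -/
def opG (α ε : ℝ) (g : ℝ → ℝ) (w χ : Plane → ℝ) : ℝ :=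
  ∫ x, g (w x) * χ x * |bdryJac α ε x / jac α ε x| ∂squareBdry

/-- The set `E_ε` of equilibria of `u_t + A_ε u = F(u) + G_ε(u)`: all `u ∈ H¹(Ω)` with
`A_ε u = F(u) + G_ε(u)` in `H^{-1}(Ω)`. -/
def equilibria (α ε a : ℝ) (f g : ℝ → ℝ) : Set (Plane → ℝ) :=
  {u | MemH1 square u ∧ ∃ w, IsTrace square squareBdry u w ∧
    ∀ ψ χ, MemH1 square ψ → IsTrace square squareBdry ψ χ →
      opA α ε a u ψ = opF f u ψ + opG α ε g w χ}

/-! ### The problem on the perturbed domain and its equilibria -/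

/-- The equilibria of the problem on `Ω_ε`: all weak solutions `v ∈ H¹(Ω_ε)` of
`Δv - a v + f(v) = 0` in `Ω_ε`, `∂v/∂N = g(v)` on `∂Ω_ε`. -/
def perturbedEquilibria (α ε a : ℝ) (f g : ℝ → ℝ) : Set (Plane → ℝ) :=
  {v | MemH1 (perturbedDomain α ε) v ∧
    ∃ w, IsTrace (perturbedDomain α ε) (perturbedBdry α ε) v w ∧
    ∀ ψ χ, MemH1 (perturbedDomain α ε) ψ →
      IsTrace (perturbedDomain α ε) (perturbedBdry α ε) ψ χ →
      (∫ y in perturbedDomain α ε,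
          inner ℝ (weakGrad (perturbedDomain α ε) v y) (weakGrad (perturbedDomain α ε) ψ y)) +
        a * (∫ y in perturbedDomain α ε, v y * ψ y) =
      (∫ y in perturbedDomain α ε, f (v y) * ψ y) + ∫ y, g (w y) * χ y ∂(perturbedBdry α ε)}

/-! ### The hypotheses on the nonlinearities -/

/-- The growth condition with exponent `lam` and constant `L`. -/
def Growth (f : ℝ → ℝ) (lam L : ℝ) : Prop :=
  0 < lam ∧ 0 < L ∧
    ∀ s t : ℝ, |f s - f t| ≤ L * (1 + |s| ^ lam + |t| ^ lam) * |s - t|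

/-- `limsup_{|s| → ∞} f(s) / s ≤ c` (the upper limit is taken in `[-∞, ∞]`; the filter
`cocompact ℝ` expresses `|s| → ∞`). -/
def LimsupQuotientLE (f : ℝ → ℝ) (c : ℝ) : Prop :=
  limsup (fun s : ℝ => ((f s / s : ℝ) : EReal)) (cocompact ℝ) ≤ (c : EReal)

/-- `μ` is an eigenvalue of the Robin problem `-Δu + (a - c₀) u = μ u` in `Ω`,
`∂u/∂N = d₀ u` on `∂Ω` (in the weak sense). -/
def IsRobinEigenvalue (a c₀ d₀ μ : ℝ) : Prop :=
  ∃ u w, MemH1 square u ∧ IsTrace square squareBdry u w ∧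
    ¬ (u =ᵐ[volume.restrict square] 0) ∧
    ∀ ψ χ, MemH1 square ψ → IsTrace square squareBdry ψ χ →
      (∫ x in square, inner ℝ (weakGrad square u x) (weakGrad square ψ x)) +
        (a - c₀) * (∫ x in square, u x * ψ x) - d₀ * (∫ x, w x * χ x ∂squareBdry) =
      μ * ∫ x in square, u x * ψ x

end OscillatingSquare

end

noncomputable section

namespace OscillatingSquare

open scoped ContDiff
open MeasureTheory Filter Topology

/-! ### Generalities on `L²` convergence -/

/-! Testing the equation with the solution `u` itself and using dissipativity, `f(s)s ≤ A s² + C`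
and `g(s)s ≤ B s² + D`, bounds the quadratic form `∫|∇u|² + (a - A)∫u² - B∫_{∂Ω}u²`, taken with the
coefficients of the perturbed problem, by a constant independent of `ε`. If the unperturbed Robin
form is coercive, then so is this one once `A` is close enough to `c₀`, `B ≤ d₀`, and the
coefficients are close to those of the square. Since `α < 1`, the derivative of `h_ε` differs from
the identity by `O(ε + ε^(1-α))`, so they are, and the `H¹` bound follows.

Coercivity needs no spectral theory. On the unit interval the first Robin eigenfunction `X > 0` is
explicit (a hyperbolic or trigonometric cosine), and `X(x)X(y)` is an eigenfunction on the square
with eigenvalue `2κ + a - c₀`, which is therefore at least `μ₁ > 0`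
(`isRobinEigenvalue_tensorSquare`). Picone's inequality on the lines parallel to the axes shows that
the Robin form is at least this eigenvalue times `∫u²` (`intervalIneq_robin`,
`IntervalIneq.integral_squareBdry_le`). A trace inequality with a small constant upgrades this to
control of `∇u` and of the trace (`exists_coercive`).

To avoid deciding whether `f(u)u` is integrable, the test functions are truncations `u ρₙ(u)`, with
`ρₙ` cut off on a logarithmic scale. Then `f(u) u ρₙ(u)` is bounded, while `(s ρₙ(s))' ≥ ρₙ(s) -
C/(n+1)` loses only a vanishing part of the gradient term (`energy_le`). The comparison with the
square is made in `coercive_of_close`; it gives `IsSmall.equilibria_bound` and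
`IsSmall.perturbedEquilibria_bound`. -/

theorem tendsto_eLpNorm_of_tendsto_integral_norm_sq {X : Type*} [MeasurableSpace X] {E : Type*}
    [NormedAddCommGroup E] {μ : Measure X} {f : ℕ → X → E}
    (hf : ∀ n, MemLp (f n) 2 μ)
    (h : Tendsto (fun n => ∫ x, ‖f n x‖ ^ 2 ∂μ) atTop (𝓝 0)) :
    Tendsto (fun n => eLpNorm (f n) 2 μ) atTop (𝓝 0) := by
  have : ∀ n, eLpNorm (f n) 2 μ = ENNReal.ofReal (Real.sqrt (∫ x, ‖f n x‖ ^ 2 ∂μ)) := by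
    intro n
    rw [(hf n).eLpNorm_eq_integral_rpow_norm (by norm_num) (by norm_num), Real.sqrt_eq_rpow]
    norm_num
  simp_rw [this]
  have h2 := (Real.continuous_sqrt.tendsto _).comp h
  rw [Real.sqrt_zero] at h2
  simpa [Function.comp_def] using (ENNReal.continuous_ofReal.tendsto _).comp h2

section L2

variable {X : Type*} [MeasurableSpace X] {E : Type*} [NormedAddCommGroup E]
  [InnerProductSpace ℝ E] {μ : Measure X}

/-- Continuity of the inner product of `L²`. Every passage from smooth functions to `H¹` below goes
through it. -/
theorem tendsto_integral_inner {f g : ℕ → X → E} {F G : X → E}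
    (hf : ∀ n, MemLp (f n) 2 μ) (hg : ∀ n, MemLp (g n) 2 μ) (hF : MemLp F 2 μ) (hG : MemLp G 2 μ)
    (hfF : Tendsto (fun n => eLpNorm (f n - F) 2 μ) atTop (𝓝 0))
    (hgG : Tendsto (fun n => eLpNorm (g n - G) 2 μ) atTop (𝓝 0)) :
    Tendsto (fun n => ∫ x, inner ℝ (f n x) (g n x) ∂μ) atTop (𝓝 (∫ x, inner ℝ (F x) (G x) ∂μ)) := by
  have key : ∀ {u v : X → E} (hu : MemLp u 2 μ) (hv : MemLp v 2 μ),
      ∫ x, inner ℝ (u x) (v x) ∂μ = inner ℝ (hu.toLp u) (hv.toLp v) := by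
    intro u v hu hv
    rw [L2.inner_def]
    refine integral_congr_ae ?_
    filter_upwards [hu.coeFn_toLp, hv.coeFn_toLp] with x h1 h2
    rw [h1, h2]
  rw [key hF hG]
  simp_rw [fun n => key (hf n) (hg n)]
  exact ((Lp.tendsto_Lp_iff_tendsto_eLpNorm'' f hf F hF).2 hfF).inner
    ((Lp.tendsto_Lp_iff_tendsto_eLpNorm'' g hg G hG).2 hgG)

theorem tendsto_integral_norm_sq_of_tendsto_eLpNorm {f : ℕ → X → E} (hf : ∀ n, MemLp (f n) 2 μ)
    (h : Tendsto (fun n => eLpNorm (f n) 2 μ) atTop (𝓝 0)) :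
    Tendsto (fun n => ∫ x, ‖f n x‖ ^ 2 ∂μ) atTop (𝓝 0) := by
  have h0 : MemLp (0 : X → E) 2 μ := MemLp.zero
  have := tendsto_integral_inner hf hf h0 h0 (by simpa using h) (by simpa using h)
  simpa [real_inner_self_eq_norm_sq] using this

theorem tendsto_integral_norm_sq {f : ℕ → X → E} {F : X → E}
    (hf : ∀ n, MemLp (f n) 2 μ) (hF : MemLp F 2 μ)
    (hfF : Tendsto (fun n => eLpNorm (f n - F) 2 μ) atTop (𝓝 0)) :
    Tendsto (fun n => ∫ x, ‖f n x‖ ^ 2 ∂μ) atTop (𝓝 (∫ x, ‖F x‖ ^ 2 ∂μ)) := by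
  simpa [real_inner_self_eq_norm_sq] using tendsto_integral_inner hf hf hF hF hfF hfF

end L2

/-- A finite measure carried by a compact set. -/
structure CompactlyCarried (μ : Measure Plane) : Prop where
  finite : IsFiniteMeasure μ
  exists_compact : ∃ K : Set Plane, IsCompact K ∧ μ Kᶜ = 0

theorem CompactlyCarried.ae_norm_le {E : Type*} [NormedAddCommGroup E] {μ : Measure Plane}
    (hμ : CompactlyCarried μ) {f : Plane → E} (hf : Continuous f) :
    ∃ C, ∀ᵐ x ∂μ, ‖f x‖ ≤ C := by
  obtain ⟨K, hK, hK0⟩ := hμ.exists_compact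
  obtain ⟨C, hC⟩ := hK.exists_bound_of_continuousOn hf.continuousOn
  refine ⟨C, ?_⟩
  rw [ae_iff]
  exact measure_mono_null (fun x hx hxK => hx (hC x hxK)) hK0

theorem CompactlyCarried.memLp {E : Type*} [NormedAddCommGroup E] {μ : Measure Plane}
    (hμ : CompactlyCarried μ) {f : Plane → E} (hf : Continuous f) (p : ENNReal) :
    MemLp f p μ := by
  have := hμ.finite
  obtain ⟨C, hC⟩ := hμ.ae_norm_le hf
  exact MemLp.of_bound hf.aestronglyMeasurable C hC

theorem CompactlyCarried.integrable {E : Type*} [NormedAddCommGroup E] {μ : Measure Plane}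
    (hμ : CompactlyCarried μ) {f : Plane → E} (hf : Continuous f) :
    Integrable f μ := memLp_one_iff_integrable.1 (hμ.memLp hf 1)

theorem compactlyCarried_restrict {Ω : Set Plane}
    (hb : Bornology.IsBounded Ω) : CompactlyCarried (volume.restrict Ω) where
  finite := ⟨by simpa using hb.measure_lt_top⟩
  exists_compact := ⟨closure Ω, hb.isCompact_closure, by
    rw [Measure.restrict_apply isClosed_closure.measurableSet.compl]
    convert measure_empty (μ := (volume : Measure Plane))
    ext x; simpa using fun h hx => h (subset_closure hx)⟩

/-! ### Weak gradients -/

theorem continuous_gradient {φ : Plane → ℝ} (hφ : ContDiff ℝ ∞ φ) : Continuous (gradient φ) :=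
  (InnerProductSpace.toDual ℝ Plane).symm.continuous.comp (hφ.continuous_fderiv (by simp))

theorem inner_gradient (φ : Plane → ℝ) (x v : Plane) :
    inner ℝ (gradient φ x) v = fderiv ℝ φ x v := by
  rw [gradient, InnerProductSpace.toDual_symm_apply]

theorem setIntegral_mul_fderiv {Ω : Set Plane} {φ ψ : Plane → ℝ}
    (hφ : ContDiff ℝ ∞ φ) (hψ : ContDiff ℝ ∞ ψ) (hc : HasCompactSupport ψ) (hs : tsupport ψ ⊆ Ω)
    (v : Plane) :
    ∫ x in Ω, φ x * fderiv ℝ ψ x v = - ∫ x in Ω, inner ℝ (gradient φ x) v * ψ x := by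
  simp_rw [inner_gradient]
  have h1 : ∀ x ∉ Ω, ψ x = 0 := fun x hx => image_eq_zero_of_notMem_tsupport fun h => hx (hs h)
  have h2 : ∀ x ∉ Ω, fderiv ℝ ψ x = 0 := fun x hx =>
    image_eq_zero_of_notMem_tsupport fun h => hx (hs (tsupport_fderiv_subset ℝ h))
  rw [setIntegral_eq_integral_of_forall_compl_eq_zero fun x hx => by simp [h2 x hx],
    setIntegral_eq_integral_of_forall_compl_eq_zero fun x hx => by simp [h1 x hx]]
  have cφ := hφ.continuous
  have cψ := hψ.continuous
  have cφ' : Continuous fun x => fderiv ℝ φ x v :=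
    (hφ.continuous_fderiv (by simp)).clm_apply continuous_const
  have cψ' : Continuous fun x => fderiv ℝ ψ x v :=
    (hψ.continuous_fderiv (by simp)).clm_apply continuous_const
  refine integral_mul_fderiv_eq_neg_fderiv_mul_of_integrable ?_ ?_ ?_
    (fun x _ => (hφ.differentiable (by simp)).differentiableAt)
    (fun x _ => (hψ.differentiable (by simp)).differentiableAt)
  · exact (cφ'.mul cψ).integrable_of_hasCompactSupport hc.mul_left
  · exact (cφ.mul cψ').integrable_of_hasCompactSupport ((hc.fderiv_apply ℝ v).mul_left)
  · exact (cφ.mul cψ).integrable_of_hasCompactSupport hc.mul_left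

theorem hasWeakGrad_of_contDiff (Ω : Set Plane) {φ : Plane → ℝ} (hφ : ContDiff ℝ ∞ φ) :
    HasWeakGrad Ω φ (gradient φ) :=
  ⟨(hφ.continuous.locallyIntegrable).locallyIntegrableOn _,
    (continuous_gradient hφ).locallyIntegrable.locallyIntegrableOn _,
    fun _ hψ hc hs v => setIntegral_mul_fderiv hφ hψ hc hs v⟩

theorem integrableOn_mul_of_tsupport_subset {Ω : Set Plane}
    {u ψ : Plane → ℝ} (hu : LocallyIntegrableOn u Ω volume) (hψ : Continuous ψ)
    (hc : HasCompactSupport ψ) (hs : tsupport ψ ⊆ Ω) :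
    IntegrableOn (fun x => u x * ψ x) Ω volume := by
  have h1 : IntegrableOn (fun x => u x * ψ x) (tsupport ψ) volume :=
    (hu.integrableOn_compact_subset hs hc).mul_continuousOn hψ.continuousOn hc
  refine (integrableOn_iff_integrable_of_support_subset (s := tsupport ψ) ?_).1 h1 |>.integrableOn
  intro x hx
  exact subset_tsupport _ (right_ne_zero_of_mul hx)

/-- The fundamental lemma of the calculus of variations, one direction at a time. As `weakGrad` is
obtained by choice, this uniqueness is what allows it to be replaced by a concrete gradient. -/
theorem HasWeakGrad.ae_eq {Ω : Set Plane} (hΩ : IsOpen Ω) {u : Plane → ℝ} {G G' : Plane → Plane}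
    (h : HasWeakGrad Ω u G) (h' : HasWeakGrad Ω u G') : G =ᵐ[volume.restrict Ω] G' := by
  have key : ∀ v : Plane, ∀ᵐ x ∂volume, x ∈ Ω → inner ℝ (G x) v - inner ℝ (G' x) v = 0 := by
    intro v
    have l1 : LocallyIntegrableOn (fun x => inner ℝ (G x) v) Ω volume := fun x hx => by
      obtain ⟨t, ht, hi⟩ := h.2.1 x hx
      exact ⟨t, ht, hi.inner_const v⟩
    have l2 : LocallyIntegrableOn (fun x => inner ℝ (G' x) v) Ω volume := fun x hx => by
      obtain ⟨t, ht, hi⟩ := h'.2.1 x hx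
      exact ⟨t, ht, hi.inner_const v⟩
    refine hΩ.ae_eq_zero_of_integral_contDiff_smul_eq_zero (l1.sub l2) ?_
    intro ψ hψ hc hs
    have i1 := integrableOn_mul_of_tsupport_subset l1 hψ.continuous hc hs
    have i2 := integrableOn_mul_of_tsupport_subset l2 hψ.continuous hc hs
    have e1 := h.2.2 ψ hψ hc hs v
    have e2 := h'.2.2 ψ hψ hc hs v
    rw [← setIntegral_eq_integral_of_forall_compl_eq_zero (s := Ω)]
    · have : ∀ x, ψ x • (inner ℝ (G x) v - inner ℝ (G' x) v)
          = inner ℝ (G x) v * ψ x - inner ℝ (G' x) v * ψ x := fun x => by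
        rw [smul_eq_mul]; ring
      simp_rw [this]
      rw [integral_sub i1 i2]
      linarith
    · intro x hx
      rw [image_eq_zero_of_notMem_tsupport fun h => hx (hs h), zero_smul]
  rw [EventuallyEq, ae_restrict_iff' hΩ.measurableSet]
  filter_upwards [key (EuclideanSpace.single 0 1), key (EuclideanSpace.single 1 1)] with x h0 h1 hx
  have h0 := h0 hx
  have h1 := h1 hx
  simp [EuclideanSpace.inner_single_right] at h0 h1
  ext i
  fin_cases i
  · simpa using sub_eq_zero.1 h0
  · simpa using sub_eq_zero.1 h1

theorem hasWeakGrad_weakGrad {Ω : Set Plane} {u : Plane → ℝ} (h : ∃ G, HasWeakGrad Ω u G) :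
    HasWeakGrad Ω u (weakGrad Ω u) := by
  rw [weakGrad, dif_pos h]; exact h.choose_spec

theorem HasWeakGrad.weakGrad_ae_eq {Ω : Set Plane} (hΩ : IsOpen Ω) {u : Plane → ℝ}
    {G : Plane → Plane} (h : HasWeakGrad Ω u G) : weakGrad Ω u =ᵐ[volume.restrict Ω] G :=
  (hasWeakGrad_weakGrad ⟨G, h⟩).ae_eq hΩ h

theorem HasWeakGrad.sub {Ω : Set Plane} {u u' : Plane → ℝ}
    {G G' : Plane → Plane} (h : HasWeakGrad Ω u G) (h' : HasWeakGrad Ω u' G') :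
    HasWeakGrad Ω (fun x => u x - u' x) (fun x => G x - G' x) := by
  refine ⟨h.1.sub h'.1, h.2.1.sub h'.2.1, fun ψ hψ hc hs v => ?_⟩
  have l1 : LocallyIntegrableOn (fun x => inner ℝ (G x) v) Ω volume := fun x hx => by
    obtain ⟨t, ht, hi⟩ := h.2.1 x hx
    exact ⟨t, ht, hi.inner_const v⟩
  have l2 : LocallyIntegrableOn (fun x => inner ℝ (G' x) v) Ω volume := fun x hx => by
    obtain ⟨t, ht, hi⟩ := h'.2.1 x hx
    exact ⟨t, ht, hi.inner_const v⟩
  have cψ' : Continuous fun x => fderiv ℝ ψ x v :=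
    (hψ.continuous_fderiv (by simp)).clm_apply continuous_const
  have hs' : tsupport (fun x => fderiv ℝ ψ x v) ⊆ Ω :=
    (tsupport_fderiv_apply_subset ℝ v).trans hs
  simp_rw [inner_sub_left, sub_mul]
  rw [integral_sub (integrableOn_mul_of_tsupport_subset h.1 cψ' (hc.fderiv_apply ℝ v) hs')
      (integrableOn_mul_of_tsupport_subset h'.1 cψ' (hc.fderiv_apply ℝ v) hs'),
    integral_sub (integrableOn_mul_of_tsupport_subset l1 hψ.continuous hc hs)
      (integrableOn_mul_of_tsupport_subset l2 hψ.continuous hc hs),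
    h.2.2 ψ hψ hc hs v, h'.2.2 ψ hψ hc hs v]
  ring

theorem MemH1.hasWeakGrad {Ω : Set Plane} {u : Plane → ℝ} (h : MemH1 Ω u) :
    HasWeakGrad Ω u (weakGrad Ω u) :=
  let ⟨_, G, _, hG⟩ := h
  hasWeakGrad_weakGrad ⟨G, hG⟩

theorem MemH1.memLp_weakGrad {Ω : Set Plane} (hΩ : IsOpen Ω) {u : Plane → ℝ} (h : MemH1 Ω u) :
    MemLp (weakGrad Ω u) 2 (volume.restrict Ω) :=
  let ⟨_, _, hG2, hG⟩ := h
  hG2.ae_eq (hG.weakGrad_ae_eq hΩ).symm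

/-! ### Triples `(u, ∇u, γ u)` as limits of smooth functions -/

/-- `(u, G, w)` is the limit in `L²(Ω) × L²(Ω) × L²(σ)` of triples `(φ, ∇φ, φ)` with `φ` smooth. -/
structure H1Approx (Ω : Set Plane) (σ : Measure Plane) (u : Plane → ℝ) (G : Plane → Plane)
    (w : Plane → ℝ) : Prop where
  memLp : MemLp u 2 (volume.restrict Ω)
  memLp_grad : MemLp G 2 (volume.restrict Ω)
  memLp_trace : MemLp w 2 σ
  exists_seq : ∃ φ : ℕ → Plane → ℝ, (∀ n, ContDiff ℝ ∞ (φ n)) ∧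
    Tendsto (fun n => eLpNorm (φ n - u) 2 (volume.restrict Ω)) atTop (𝓝 0) ∧
    Tendsto (fun n => eLpNorm (gradient (φ n) - G) 2 (volume.restrict Ω)) atTop (𝓝 0) ∧
    Tendsto (fun n => eLpNorm (φ n - w) 2 σ) atTop (𝓝 0)

theorem H1Approx.of_contDiff {Ω : Set Plane} (hb : Bornology.IsBounded Ω) {σ : Measure Plane}
    (hσ : CompactlyCarried σ) {φ : Plane → ℝ} (hφ : ContDiff ℝ ∞ φ) :
    H1Approx Ω σ φ (gradient φ) φ where
  memLp := (compactlyCarried_restrict hb).memLp hφ.continuous 2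
  memLp_grad := (compactlyCarried_restrict hb).memLp (continuous_gradient hφ) 2
  memLp_trace := hσ.memLp hφ.continuous 2
  exists_seq := ⟨fun _ => φ, fun _ => hφ, by simp, by simp, by simp⟩

/-- Integration by parts holds for each smooth approximant, and both sides are `L²` pairings with a
fixed function, so it survives the limit. -/
theorem H1Approx.hasWeakGrad {Ω : Set Plane} (hb : Bornology.IsBounded Ω)
    {σ : Measure Plane} {u w : Plane → ℝ} {G : Plane → Plane} (h : H1Approx Ω σ u G w) :
    HasWeakGrad Ω u G := by
  have hc := compactlyCarried_restrict hb
  have := hc.finite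
  refine ⟨IntegrableOn.locallyIntegrableOn (h.memLp.integrable (by norm_num)),
    IntegrableOn.locallyIntegrableOn (h.memLp_grad.integrable (by norm_num)),
    fun ψ hψ hcs hs v => ?_⟩
  obtain ⟨φ, hφ, h1, h2, -⟩ := h.exists_seq
  have cψ' : Continuous fun x => fderiv ℝ ψ x v :=
    (hψ.continuous_fderiv (by simp)).clm_apply continuous_const
  have cψ : Continuous fun x => ψ x • v := hψ.continuous.smul continuous_const
  have t1 := tendsto_integral_inner (f := φ) (g := fun _ x => fderiv ℝ ψ x v)
    (fun n => hc.memLp (hφ n).continuous 2) (fun _ => hc.memLp cψ' 2) h.memLp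
    (hc.memLp cψ' 2) h1 (by simp)
  have t2 := tendsto_integral_inner (f := fun n => gradient (φ n)) (g := fun _ x => ψ x • v)
    (fun n => hc.memLp (continuous_gradient (hφ n)) 2) (fun _ => hc.memLp cψ 2) h.memLp_grad
    (hc.memLp cψ 2) h2 (by simp)
  have e : ∀ n, ∫ x in Ω, inner ℝ (φ n x) (fderiv ℝ ψ x v)
      = - ∫ x in Ω, inner ℝ (gradient (φ n) x) (ψ x • v) := fun n => by
    have := setIntegral_mul_fderiv (hφ n) hψ hcs hs v
    simpa [inner_smul_right, mul_comm] using this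
  have := tendsto_nhds_unique (t1.congr e) t2.neg
  simpa [inner_smul_right, mul_comm] using this

theorem H1Approx.memH1 {Ω : Set Plane} (hb : Bornology.IsBounded Ω)
    {σ : Measure Plane} {u w : Plane → ℝ} {G : Plane → Plane} (h : H1Approx Ω σ u G w) :
    MemH1 Ω u := ⟨h.memLp, G, h.memLp_grad, h.hasWeakGrad hb⟩

theorem H1Approx.weakGrad_ae_eq {Ω : Set Plane} (hΩ : IsOpen Ω) (hb : Bornology.IsBounded Ω)
    {σ : Measure Plane} {u w : Plane → ℝ} {G : Plane → Plane} (h : H1Approx Ω σ u G w) :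
    weakGrad Ω u =ᵐ[volume.restrict Ω] G := (h.hasWeakGrad hb).weakGrad_ae_eq hΩ

theorem weakGrad_sub_ae_eq {Ω : Set Plane} (hΩ : IsOpen Ω) {φ u : Plane → ℝ} {G : Plane → Plane}
    (hφ : ContDiff ℝ ∞ φ) (hu : HasWeakGrad Ω u G) :
    weakGrad Ω (fun x => φ x - u x) =ᵐ[volume.restrict Ω] gradient φ - G :=
  ((hasWeakGrad_of_contDiff Ω hφ).sub hu).weakGrad_ae_eq hΩ

/-- With `IsTrace.h1Approx`, this shows that `H1Approx` is the notion of trace with the gradient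
made explicit. Its three separate `L²` limits are easier to handle than a limit of `h1Norm`. -/
theorem H1Approx.isTrace {Ω : Set Plane} (hΩ : IsOpen Ω) (hb : Bornology.IsBounded Ω)
    {σ : Measure Plane} {u w : Plane → ℝ} {G : Plane → Plane} (h : H1Approx Ω σ u G w) :
    IsTrace Ω σ u w := by
  refine ⟨h.memH1 hb, h.memLp_trace, ?_⟩
  obtain ⟨φ, hφ, h1, h2, h3⟩ := h.exists_seq
  refine ⟨φ, hφ, ?_, h3⟩
  have hc := compactlyCarried_restrict hb
  have t1 := tendsto_integral_norm_sq_of_tendsto_eLpNorm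
    (fun n => (hc.memLp (hφ n).continuous 2).sub h.memLp) h1
  have t2 := tendsto_integral_norm_sq_of_tendsto_eLpNorm
    (fun n => (hc.memLp (continuous_gradient (hφ n)) 2).sub h.memLp_grad) h2
  have t := (Real.continuous_sqrt.tendsto _).comp (t1.add t2)
  simp only [add_zero, Real.sqrt_zero] at t
  refine t.congr fun n => ?_
  simp only [Function.comp, h1Norm]
  congr 2
  · simp
  · refine integral_congr_ae ?_
    filter_upwards [weakGrad_sub_ae_eq hΩ (hφ n) (h.hasWeakGrad hb)] with x hx
    rw [hx]

theorem IsTrace.h1Approx {Ω : Set Plane} (hΩ : IsOpen Ω) (hb : Bornology.IsBounded Ω)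
    {σ : Measure Plane} {u w : Plane → ℝ} (h : IsTrace Ω σ u w) :
    H1Approx Ω σ u (weakGrad Ω u) w := by
  obtain ⟨hu, hw, φ, hφ, h1, h3⟩ := h
  have hc := compactlyCarried_restrict hb
  have m1 : ∀ n, MemLp (φ n - u) 2 (volume.restrict Ω) :=
    fun n => (hc.memLp (hφ n).continuous 2).sub hu.1
  have m2 : ∀ n, MemLp (gradient (φ n) - weakGrad Ω u) 2 (volume.restrict Ω) :=
    fun n => (hc.memLp (continuous_gradient (hφ n)) 2).sub (hu.memLp_weakGrad hΩ)
  refine ⟨hu.1, hu.memLp_weakGrad hΩ, hw, φ, hφ, ?_, ?_, h3⟩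
  all_goals
    have h1 := h1.pow 2
    simp only [h1Norm] at h1
    have e : ∀ n, (∫ x in Ω, (φ n x - u x) ^ 2)
        + ∫ x in Ω, ‖weakGrad Ω (fun x => φ n x - u x) x‖ ^ 2
        = (∫ x in Ω, ‖(φ n - u) x‖ ^ 2) + ∫ x in Ω, ‖(gradient (φ n) - weakGrad Ω u) x‖ ^ 2 := by
      intro n
      congr 1
      · simp
      · refine integral_congr_ae ?_
        filter_upwards [weakGrad_sub_ae_eq hΩ (hφ n) hu.hasWeakGrad] with x hx
        rw [hx]
    have p1 : ∀ n, 0 ≤ ∫ x in Ω, ‖(φ n - u) x‖ ^ 2 := fun n => by positivity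
    have p2 : ∀ n, 0 ≤ ∫ x in Ω, ‖(gradient (φ n) - weakGrad Ω u) x‖ ^ 2 := fun n => by positivity
    simp_rw [e, fun n => Real.sq_sqrt (add_nonneg (p1 n) (p2 n))] at h1
    rw [zero_pow two_ne_zero] at h1
  · exact tendsto_eLpNorm_of_tendsto_integral_norm_sq m1
      (squeeze_zero p1 (fun n => le_add_of_nonneg_right (p2 n)) h1)
  · exact tendsto_eLpNorm_of_tendsto_integral_norm_sq m2
      (squeeze_zero p2 (fun n => le_add_of_nonneg_left (p1 n)) h1)

/-! ### Compositions and products -/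

theorem gradient_mul {φ J : Plane → ℝ} (hφ : ContDiff ℝ ∞ φ) (hJ : ContDiff ℝ ∞ J) (x : Plane) :
    gradient (φ * J) x = J x • gradient φ x + φ x • gradient J x := by
  refine ext_inner_right ℝ fun v => ?_
  have d1 := (hφ.differentiable (by simp)).differentiableAt (x := x)
  have d2 := (hJ.differentiable (by simp)).differentiableAt (x := x)
  rw [inner_add_left, real_inner_smul_left, real_inner_smul_left, inner_gradient, inner_gradient,
    inner_gradient, fderiv_mul d1 d2]
  simp [add_comm]

theorem gradient_comp {φ : Plane → ℝ} {θ : ℝ → ℝ} (hφ : ContDiff ℝ ∞ φ) (hθ : ContDiff ℝ ∞ θ)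
    (x : Plane) : gradient (θ ∘ φ) x = deriv θ (φ x) • gradient φ x := by
  refine ext_inner_right ℝ fun v => ?_
  have d1 := (hφ.differentiable (by simp)).differentiableAt (x := x)
  have d2 := (hθ.differentiable (by simp)).differentiableAt (x := φ x)
  rw [real_inner_smul_left, inner_gradient, inner_gradient, fderiv_comp x d2 d1]
  simp [mul_comm]

theorem tendsto_eLpNorm_add {E : Type*} [NormedAddCommGroup E] {μ : Measure Plane}
    {f g : ℕ → Plane → E}
    (mf : ∀ n, AEStronglyMeasurable (f n) μ) (mg : ∀ n, AEStronglyMeasurable (g n) μ)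
    (hf : Tendsto (fun n => eLpNorm (f n) 2 μ) atTop (𝓝 0))
    (hg : Tendsto (fun n => eLpNorm (g n) 2 μ) atTop (𝓝 0)) :
    Tendsto (fun n => eLpNorm (f n + g n) 2 μ) atTop (𝓝 0) := by
  have t := hf.add hg
  rw [add_zero] at t
  exact tendsto_of_tendsto_of_tendsto_of_le_of_le tendsto_const_nhds t (fun _ => zero_le)
    fun n => eLpNorm_add_le (mf n) (mg n) (by norm_num)

section L2

variable {E : Type*} [NormedAddCommGroup E] [InnerProductSpace ℝ E] {μ : Measure Plane}

theorem tendsto_eLpNorm_smul_of_bounded {f : ℕ → Plane → E} {m : ℕ → Plane → ℝ} {C : ℝ}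
    (hm : ∀ n, ∀ᵐ x ∂μ, |m n x| ≤ C)
    (hf : Tendsto (fun n => eLpNorm (f n) 2 μ) atTop (𝓝 0)) :
    Tendsto (fun n => eLpNorm (fun x => m n x • f n x) 2 μ) atTop (𝓝 0) := by
  have b : ∀ n, eLpNorm (fun x => m n x • f n x) 2 μ ≤ ENNReal.ofReal C * eLpNorm (f n) 2 μ := by
    intro n
    refine eLpNorm_le_mul_eLpNorm_of_ae_le_mul ?_ 2
    filter_upwards [hm n] with x hx
    rw [norm_smul]
    exact mul_le_mul_of_nonneg_right hx (norm_nonneg _)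
  have t := ENNReal.Tendsto.const_mul (a := ENNReal.ofReal C) hf (Or.inr ENNReal.ofReal_ne_top)
  rw [mul_zero] at t
  exact tendsto_of_tendsto_of_tendsto_of_le_of_le tendsto_const_nhds t (fun _ => zero_le) b

/-- Dominated convergence in `L²` for bounded multipliers. -/
theorem tendsto_eLpNorm_smul_of_tendsto_ae {m : ℕ → Plane → ℝ} {G : Plane → E} {C : ℝ}
    (hmm : ∀ n, AEStronglyMeasurable (m n) μ)
    (hm : ∀ n x, |m n x| ≤ C) (hG : MemLp G 2 μ)
    (h : ∀ᵐ x ∂μ, Tendsto (fun n => m n x) atTop (𝓝 0)) :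
    Tendsto (fun n => eLpNorm (fun x => m n x • G x) 2 μ) atTop (𝓝 0) := by
  have hi : Integrable (fun x => ‖G x‖ ^ 2) μ := hG.integrable_norm_pow (by norm_num)
  have hmG : ∀ n, MemLp (fun x => m n x • G x) 2 μ := fun n =>
    hG.of_le_mul (c := C) ((hmm n).smul hG.1) (Eventually.of_forall fun x => by
      rw [norm_smul]
      exact mul_le_mul_of_nonneg_right (hm n x) (norm_nonneg _))
  refine tendsto_eLpNorm_of_tendsto_integral_norm_sq hmG ?_
  rw [← integral_zero Plane ℝ (μ := μ)]
  refine tendsto_integral_of_dominated_convergence (fun x => C ^ 2 * ‖G x‖ ^ 2)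
    (fun n => ((hmG n).1.norm.pow 2)) (hi.const_mul _) (fun n => Eventually.of_forall fun x => ?_) ?_
  · rw [norm_smul, mul_pow, Real.norm_of_nonneg (by positivity), Real.norm_eq_abs]
    gcongr
    exact hm n x
  · filter_upwards [h] with x hx
    have := ((hx.smul_const (G x)).norm).pow 2
    simpa using this

end L2

/-- The product rule, with traces. It is needed because the test functions of the pulled-back
problem carry the factor `jac`. -/
theorem H1Approx.mul {Ω : Set Plane} (hb : Bornology.IsBounded Ω) {σ : Measure Plane}
    (hσ : CompactlyCarried σ) {u w J : Plane → ℝ} {G : Plane → Plane} (hJ : ContDiff ℝ ∞ J)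
    (h : H1Approx Ω σ u G w) :
    H1Approx Ω σ (fun x => u x * J x) (fun x => J x • G x + u x • gradient J x)
      (fun x => w x * J x) := by
  have hc := compactlyCarried_restrict hb
  have cJ := hJ.continuous
  have cJ' := continuous_gradient hJ
  obtain ⟨C, hC⟩ := hc.ae_norm_le cJ
  obtain ⟨C', hC'⟩ := hc.ae_norm_le cJ'
  obtain ⟨D, hD⟩ := hσ.ae_norm_le cJ
  obtain ⟨φ, hφ, h1, h2, h3⟩ := h.exists_seq
  have mu : MemLp (fun x => u x • gradient J x) 2 (volume.restrict Ω) :=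
    h.memLp.of_le_mul (c := C') (h.memLp.1.smul cJ'.aestronglyMeasurable) (by
      filter_upwards [hC'] with x hx
      rw [norm_smul, mul_comm]
      exact mul_le_mul_of_nonneg_right hx (norm_nonneg _))
  have mG : MemLp (fun x => J x • G x) 2 (volume.restrict Ω) :=
    h.memLp_grad.of_le_mul (c := C) (cJ.aestronglyMeasurable.smul h.memLp_grad.1) (by
      filter_upwards [hC] with x hx
      rw [norm_smul]
      exact mul_le_mul_of_nonneg_right hx (norm_nonneg _))
  refine ⟨h.memLp.of_le_mul (c := C) (h.memLp.1.mul cJ.aestronglyMeasurable) ?_, mG.add mu,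
    h.memLp_trace.of_le_mul (c := D) (h.memLp_trace.1.mul cJ.aestronglyMeasurable) ?_,
    fun n => φ n * J, fun n => (hφ n).mul hJ, ?_, ?_, ?_⟩
  · filter_upwards [hC] with x hx
    rw [norm_mul, mul_comm]
    exact mul_le_mul_of_nonneg_right hx (norm_nonneg _)
  · filter_upwards [hD] with x hx
    rw [norm_mul, mul_comm]
    exact mul_le_mul_of_nonneg_right hx (norm_nonneg _)
  · refine (tendsto_eLpNorm_smul_of_bounded (m := fun _ => J) (fun _ => hC) h1).congr fun n => ?_
    congr 1; ext x; simp; ring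
  · have e : ∀ n, gradient (φ n * J) - (fun x => J x • G x + u x • gradient J x)
        = (fun x => J x • (gradient (φ n) - G) x) + fun x => (φ n - u) x • gradient J x := by
      intro n; ext1 x
      simp only [Pi.sub_apply, Pi.add_apply, gradient_mul (hφ n) hJ, smul_sub, sub_smul]
      abel
    simp_rw [e]
    refine tendsto_eLpNorm_add
      (fun n => cJ.aestronglyMeasurable.smul
        ((continuous_gradient (hφ n)).aestronglyMeasurable.sub h.memLp_grad.1))
      (fun n => ((hφ n).continuous.aestronglyMeasurable.sub h.memLp.1).smul
        cJ'.aestronglyMeasurable)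
      (tendsto_eLpNorm_smul_of_bounded (m := fun _ => J) (fun _ => hC) h2) ?_
    have := tendsto_eLpNorm_smul_of_bounded (m := fun _ x => ‖gradient J x‖) (fun _ => by
      simpa using hC') h1
    refine this.congr fun n => eLpNorm_congr_norm_ae (Eventually.of_forall fun x => ?_)
    simp [norm_smul, mul_comm]
  · refine (tendsto_eLpNorm_smul_of_bounded (m := fun _ => J) (fun _ => hD) h3).congr fun n => ?_
    congr 1; ext x; simp; ring

theorem abs_sub_le_of_deriv_le {θ : ℝ → ℝ} {C : ℝ} (hθ : ContDiff ℝ ∞ θ)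
    (hC : ∀ s, |deriv θ s| ≤ C) (s t : ℝ) : |θ s - θ t| ≤ C * |s - t| :=
  Convex.norm_image_sub_le_of_norm_deriv_le (s := Set.univ) (f := θ)
    (fun x _ => (hθ.differentiable (by simp)).differentiableAt) (fun x _ => hC x) convex_univ
    (Set.mem_univ t) (Set.mem_univ s)

theorem tendsto_eLpNorm_comp {θ : ℝ → ℝ} {C : ℝ} (hθ : ContDiff ℝ ∞ θ)
    (hC : ∀ s, |deriv θ s| ≤ C) {μ : Measure Plane} {φ : ℕ → Plane → ℝ} {u : Plane → ℝ}
    (h : Tendsto (fun n => eLpNorm (φ n - u) 2 μ) atTop (𝓝 0)) :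
    Tendsto (fun n => eLpNorm (θ ∘ φ n - θ ∘ u) 2 μ) atTop (𝓝 0) := by
  have t := ENNReal.Tendsto.const_mul (a := ENNReal.ofReal C) h (Or.inr ENNReal.ofReal_ne_top)
  rw [mul_zero] at t
  exact tendsto_of_tendsto_of_tendsto_of_le_of_le tendsto_const_nhds t (fun _ => zero_le)
    fun n => eLpNorm_le_mul_eLpNorm_of_ae_le_mul
      (Eventually.of_forall fun x => abs_sub_le_of_deriv_le hθ hC _ _) 2

/-- The chain rule in `H¹`, with traces. -/
theorem H1Approx.comp {Ω : Set Plane} (hb : Bornology.IsBounded Ω) {σ : Measure Plane}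
    (hσ : CompactlyCarried σ) {u w : Plane → ℝ} {G : Plane → Plane} {θ : ℝ → ℝ} {C : ℝ}
    (hθ : ContDiff ℝ ∞ θ) (hC : ∀ s, |deriv θ s| ≤ C) (h : H1Approx Ω σ u G w) :
    H1Approx Ω σ (θ ∘ u) (fun x => deriv θ (u x) • G x) (θ ∘ w) := by
  have hc := compactlyCarried_restrict hb
  have fin1 := hc.finite
  have fin2 := hσ.finite
  obtain ⟨φ, hφ, h1, h2, h3⟩ := h.exists_seq
  have cθ' : Continuous (deriv θ) := hθ.continuous_deriv (by simp)
  have aux : ∀ {μ : Measure Plane} [IsFiniteMeasure μ] {v : Plane → ℝ}, MemLp v 2 μ →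
      MemLp (θ ∘ v) 2 μ := by
    intro μ _ v hv
    have m0 : MemLp (θ ∘ v - fun _ => θ 0) 2 μ :=
      hv.of_le_mul (c := C)
        ((hθ.continuous.comp_aestronglyMeasurable hv.1).sub aestronglyMeasurable_const)
        (Eventually.of_forall fun x => by
          simpa using abs_sub_le_of_deriv_le hθ hC (v x) 0)
    simpa using m0.add (memLp_const (θ 0))
  refine ⟨aux h.memLp, ?_, aux h.memLp_trace, ?_⟩
  · refine h.memLp_grad.of_le_mul (c := C)
      ((cθ'.comp_aestronglyMeasurable h.memLp.1).smul h.memLp_grad.1)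
      (Eventually.of_forall fun x => ?_)
    rw [norm_smul]
    exact mul_le_mul_of_nonneg_right (hC _) (norm_nonneg _)
  -- `θ'` is only known to be bounded and continuous, so `θ'(φₙ) → θ'(u)` is obtained almost
  -- everywhere along a subsequence, and dominated convergence does the rest.
  obtain ⟨ns, hns, hae⟩ := (tendstoInMeasure_of_tendsto_eLpNorm (by norm_num)
    (fun n => (hφ n).continuous.aestronglyMeasurable) h.memLp.1 h1).exists_seq_tendsto_ae
  have hns := hns.tendsto_atTop
  refine ⟨fun n => θ ∘ φ (ns n), fun n => hθ.comp (hφ _),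
    (tendsto_eLpNorm_comp hθ hC h1).comp hns, ?_, (tendsto_eLpNorm_comp hθ hC h3).comp hns⟩
  have e : ∀ n, gradient (θ ∘ φ (ns n)) - (fun x => deriv θ (u x) • G x)
      = (fun x => deriv θ (φ (ns n) x) • (gradient (φ (ns n)) - G) x)
        + fun x => (deriv θ (φ (ns n) x) - deriv θ (u x)) • G x := by
    intro n; ext1 x
    simp only [Pi.sub_apply, Pi.add_apply, gradient_comp (hφ (ns n)) hθ, smul_sub, sub_smul]
    abel
  simp_rw [e]
  have mm : ∀ n, AEStronglyMeasurable (fun x => deriv θ (φ (ns n) x)) (volume.restrict Ω) :=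
    fun n => (cθ'.comp (hφ _).continuous).aestronglyMeasurable
  have mu : AEStronglyMeasurable (fun x => deriv θ (u x)) (volume.restrict Ω) :=
    cθ'.comp_aestronglyMeasurable h.memLp.1
  refine tendsto_eLpNorm_add
    (fun n => (mm n).smul ((continuous_gradient (hφ _)).aestronglyMeasurable.sub h.memLp_grad.1))
    (fun n => ((mm n).sub mu).smul h.memLp_grad.1) ?_ ?_
  · exact tendsto_eLpNorm_smul_of_bounded (m := fun n x => deriv θ (φ (ns n) x))
      (fun n => Eventually.of_forall fun x => hC _) (h2.comp hns)
  · refine tendsto_eLpNorm_smul_of_tendsto_ae (C := 2 * C) (fun n => (mm n).sub mu)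
      (fun n x => ?_) h.memLp_grad ?_
    · have := abs_sub (deriv θ (φ (ns n) x)) (deriv θ (u x))
      linarith [hC (φ (ns n) x), hC (u x)]
    · filter_upwards [hae] with x hx
      have := ((cθ'.tendsto (u x)).comp hx).sub_const (deriv θ (u x))
      simpa using this

/-! ### The square and its boundary measure -/

theorem isOpen_square : IsOpen square := by
  have h0 : Continuous fun x : Plane => x 0 := by fun_prop
  have h1 : Continuous fun x : Plane => x 1 := by fun_prop
  exact (isOpen_lt continuous_const h0).inter ((isOpen_lt h0 continuous_const).inter
    ((isOpen_lt continuous_const h1).inter (isOpen_lt h1 continuous_const)))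

theorem isBounded_of_abs_le {s : Set Plane} {C : ℝ} (h : ∀ x ∈ s, |x 0| ≤ C ∧ |x 1| ≤ C) :
    Bornology.IsBounded s := by
  refine (Metric.isBounded_closedBall (x := (0 : Plane)) (r := 2 * C)).subset fun x hx => ?_
  obtain ⟨h0, h1⟩ := h x hx
  rw [mem_closedBall_zero_iff, EuclideanSpace.norm_eq]
  have hC : 0 ≤ C := (abs_nonneg _).trans h0
  refine Real.sqrt_le_iff.2 ⟨by positivity, ?_⟩
  simp only [Fin.sum_univ_two, Real.norm_eq_abs]
  nlinarith [mul_self_le_mul_self (abs_nonneg _) h0, mul_self_le_mul_self (abs_nonneg _) h1]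

theorem isBounded_square : Bornology.IsBounded square :=
  isBounded_of_abs_le (C := 1) fun x ⟨h0, h1, h2, h3⟩ => by
    constructor <;> rw [abs_le] <;> constructor <;> linarith

theorem continuous_mk : Continuous fun p : ℝ × ℝ => (!₂[p.1, p.2] : Plane) := by
  refine (PiLp.continuous_toLp 2 _).comp (continuous_pi fun i => ?_)
  fin_cases i
  · exact continuous_fst
  · exact continuous_snd

theorem measurePreserving_mk : MeasurePreserving (fun p : ℝ × ℝ => (!₂[p.1, p.2] : Plane)) ∧
    MeasurableEmbedding (fun p : ℝ × ℝ => (!₂[p.1, p.2] : Plane)) := by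
  have h1 := (EuclideanSpace.volume_preserving_symm_measurableEquiv_toLp (Fin 2)).symm
  have h2 := (volume_preserving_finTwoArrow ℝ).symm
  have e : (fun p : ℝ × ℝ => (!₂[p.1, p.2] : Plane)) =
    ((MeasurableEquiv.finTwoArrow (α := ℝ)).symm.trans
      (MeasurableEquiv.toLp 2 (Fin 2 → ℝ)).symm.symm) := by
    ext p i
    fin_cases i <;> rfl
  rw [e]
  exact ⟨h1.comp h2, MeasurableEquiv.measurableEmbedding _⟩

theorem integral_square {F : Plane → ℝ} (hF : Continuous F) :
    ∫ x in square, F x = ∫ x in (0 : ℝ)..1, ∫ y in (0 : ℝ)..1, F !₂[x, y] := by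
  have hp : (fun p : ℝ × ℝ => (!₂[p.1, p.2] : Plane)) ⁻¹' square
      = Set.Ioo (0 : ℝ) 1 ×ˢ Set.Ioo (0 : ℝ) 1 := by
    ext p; simp [square, and_assoc]
  have hc : Continuous fun p : ℝ × ℝ => F !₂[p.1, p.2] := hF.comp continuous_mk
  rw [← measurePreserving_mk.1.setIntegral_preimage_emb measurePreserving_mk.2, hp,
    Measure.volume_eq_prod, setIntegral_prod]
  · simp_rw [intervalIntegral.integral_of_le zero_le_one, integral_Ioc_eq_integral_Ioo]
  · exact (hc.continuousOn.integrableOn_compact (isCompact_Icc.prod isCompact_Icc)).mono_set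
      (Set.prod_mono Set.Ioo_subset_Icc_self Set.Ioo_subset_Icc_self)

theorem integral_square_swap {F : Plane → ℝ} (hF : Continuous F) :
    ∫ x in square, F x = ∫ y in (0 : ℝ)..1, ∫ x in (0 : ℝ)..1, F !₂[x, y] := by
  have hc : Continuous fun p : ℝ × ℝ => F !₂[p.1, p.2] := hF.comp continuous_mk
  rw [integral_square hF]
  refine intervalIntegral_intervalIntegral_swap
    ((hc.continuousOn.integrableOn_compact (isCompact_Icc.prod isCompact_Icc)).mono_set
      (Set.prod_mono (s₂ := Set.Icc 0 1) (t₂ := Set.Icc 0 1) ?_ ?_)) <;>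
  · rw [Set.uIoc_of_le zero_le_one]
    exact Set.Ioc_subset_Icc_self

theorem continuous_slice {F : Plane → ℝ} (hF : Continuous F) :
    (Continuous fun y => ∫ x in (0 : ℝ)..1, F !₂[x, y]) ∧
      Continuous fun x => ∫ y in (0 : ℝ)..1, F !₂[x, y] := by
  have hc : Continuous fun p : ℝ × ℝ => F !₂[p.1, p.2] := hF.comp continuous_mk
  exact ⟨intervalIntegral.continuous_parametric_intervalIntegral_of_continuous'
      (f := fun y x => F !₂[x, y]) (hc.comp continuous_swap) 0 1,
    intervalIntegral.continuous_parametric_intervalIntegral_of_continuous'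
      (f := fun x y => F !₂[x, y]) hc 0 1⟩

theorem compactlyCarried_arcMeasure {c : ℝ → Plane} (hc : ContDiff ℝ 1 c) :
    CompactlyCarried (arcMeasure c) := by
  have cc := hc.continuous
  have cd : Continuous fun s => ‖deriv c s‖ := (hc.continuous_deriv le_rfl).norm
  constructor
  · have : IsFiniteMeasure ((volume.restrict (Set.Icc (0 : ℝ) 1)).withDensity
        (fun s => ENNReal.ofReal ‖deriv c s‖)) :=
      isFiniteMeasure_withDensity_ofReal
        ((cd.continuousOn.integrableOn_compact isCompact_Icc).2)
    unfold arcMeasure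
    infer_instance
  · refine ⟨c '' Set.Icc 0 1, isCompact_Icc.image cc, ?_⟩
    rw [arcMeasure, Measure.map_apply cc.measurable
      (isCompact_Icc.image cc).isClosed.measurableSet.compl]
    refine withDensity_absolutelyContinuous _ _ ?_
    rw [Measure.restrict_apply (cc.measurable
      (isCompact_Icc.image cc).isClosed.measurableSet.compl)]
    convert measure_empty (μ := (volume : Measure ℝ))
    ext s
    simp only [Set.mem_inter_iff, Set.mem_preimage, Set.mem_compl_iff, Set.mem_empty_iff_false,
      iff_false, not_and]
    exact fun h1 h2 => h1 ⟨s, h2, rfl⟩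

theorem CompactlyCarried.sum {μ : Fin 4 → Measure Plane} (h : ∀ i, CompactlyCarried (μ i)) :
    CompactlyCarried (∑ i, μ i) := by
  have := fun i => (h i).finite
  choose K hK hK0 using fun i => (h i).exists_compact
  refine ⟨inferInstance, ⋃ i, K i, isCompact_iUnion hK, ?_⟩
  rw [Measure.finsetSum_apply]
  exact Finset.sum_eq_zero fun i _ => measure_mono_null
    (Set.compl_subset_compl.2 (Set.subset_iUnion K i)) (hK0 i)

theorem integral_arcMeasure {c : ℝ → Plane} (hc : ContDiff ℝ 1 c) {F : Plane → ℝ}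
    (hF : Continuous F) :
    ∫ x, F x ∂(arcMeasure c) = ∫ s in (0 : ℝ)..1, ‖deriv c s‖ * F (c s) := by
  have cd : Continuous fun s => ‖deriv c s‖ := (hc.continuous_deriv le_rfl).norm
  rw [arcMeasure, integral_map hc.continuous.aemeasurable hF.aestronglyMeasurable,
    integral_withDensity_eq_integral_toReal_smul₀ (by fun_prop) (by simp),
    intervalIntegral.integral_of_le zero_le_one, integral_Icc_eq_integral_Ioc]
  simp

theorem contDiff_mk {f g : ℝ → ℝ} {n : WithTop ℕ∞} (hf : ContDiff ℝ n f) (hg : ContDiff ℝ n g) :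
    ContDiff ℝ n fun s => (!₂[f s, g s] : Plane) := by
  rw [contDiff_euclidean]
  intro i
  fin_cases i
  · exact hf
  · exact hg

theorem hasDerivAt_mk {f g : ℝ → ℝ} {f' g' s : ℝ} (hf : HasDerivAt f f' s)
    (hg : HasDerivAt g g' s) : HasDerivAt (fun s => (!₂[f s, g s] : Plane)) !₂[f', g'] s := by
  have h : HasDerivAt (fun s => (![f s, g s] : Fin 2 → ℝ)) ![f', g'] s := by
    refine hasDerivAt_pi.2 fun i => ?_
    fin_cases i
    · exact hf
    · exact hg
  exact (PiLp.hasFDerivAt_toLp (𝕜 := ℝ) 2 (E := fun _ : Fin 2 => ℝ) _).comp_hasDerivAt s h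

theorem norm_mk (a b : ℝ) : ‖(!₂[a, b] : Plane)‖ = Real.sqrt (a ^ 2 + b ^ 2) := by
  simp [EuclideanSpace.norm_eq]

theorem contDiff_side (i : Fin 4) : ContDiff ℝ ∞ (side i) := by
  fin_cases i
  exacts [contDiff_mk contDiff_id contDiff_const, contDiff_mk contDiff_id contDiff_const,
    contDiff_mk contDiff_const contDiff_id, contDiff_mk contDiff_const contDiff_id]

theorem norm_deriv_side (i : Fin 4) (s : ℝ) : ‖deriv (side i) s‖ = 1 := by
  have h := hasDerivAt_id' s
  have c := fun a : ℝ => hasDerivAt_const s a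
  fin_cases i
  · change ‖deriv (fun s : ℝ => (!₂[s, 0] : Plane)) s‖ = 1
    rw [(hasDerivAt_mk h (c 0)).deriv, norm_mk]; simp
  · change ‖deriv (fun s : ℝ => (!₂[s, 1] : Plane)) s‖ = 1
    rw [(hasDerivAt_mk h (c 1)).deriv, norm_mk]; simp
  · change ‖deriv (fun s : ℝ => (!₂[0, s] : Plane)) s‖ = 1
    rw [(hasDerivAt_mk (c 0) h).deriv, norm_mk]; simp
  · change ‖deriv (fun s : ℝ => (!₂[1, s] : Plane)) s‖ = 1
    rw [(hasDerivAt_mk (c 1) h).deriv, norm_mk]; simp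

theorem compactlyCarried_squareBdry : CompactlyCarried squareBdry :=
  CompactlyCarried.sum fun i => compactlyCarried_arcMeasure ((contDiff_side i).of_le (by simp))

theorem integral_squareBdry {F : Plane → ℝ} (hF : Continuous F) :
    ∫ x, F x ∂squareBdry = (∫ s in (0 : ℝ)..1, F !₂[s, 0]) + (∫ s in (0 : ℝ)..1, F !₂[s, 1])
      + (∫ s in (0 : ℝ)..1, F !₂[0, s]) + ∫ s in (0 : ℝ)..1, F !₂[1, s] := by
  have hs : ∀ i, ContDiff ℝ 1 (side i) := fun i => (contDiff_side i).of_le (by simp)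
  rw [squareBdry, integral_finsetSum_measure fun i _ =>
    (compactlyCarried_arcMeasure (hs i)).integrable hF]
  simp_rw [integral_arcMeasure (hs _) hF, norm_deriv_side, one_mul, Fin.sum_univ_four]
  rfl

theorem hasDerivAt_slice {φ : Plane → ℝ} (hφ : ContDiff ℝ ∞ φ) (x y : ℝ) :
    HasDerivAt (fun s => φ !₂[s, y]) (gradient φ !₂[x, y] 0) x ∧
      HasDerivAt (fun s => φ !₂[x, s]) (gradient φ !₂[x, y] 1) y := by
  have d := (hφ.differentiable (by simp)).differentiableAt (x := (!₂[x, y] : Plane))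
  have e : ∀ a b : ℝ, fderiv ℝ φ !₂[x, y] !₂[a, b]
      = gradient φ !₂[x, y] 0 * a + gradient φ !₂[x, y] 1 * b := fun a b => by
    rw [← inner_gradient, PiLp.inner_apply, Fin.sum_univ_two]; simp [mul_comm]
  constructor
  · have := d.hasFDerivAt.comp_hasDerivAt x (hasDerivAt_mk (hasDerivAt_id' x) (hasDerivAt_const x y))
    rw [e] at this
    simpa [Function.comp_def] using this
  · have := d.hasFDerivAt.comp_hasDerivAt y (hasDerivAt_mk (hasDerivAt_const y x) (hasDerivAt_id' y))
    rw [e] at this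
    simpa [Function.comp_def] using this

/-! ### Quadratic inequalities on the interval and on the square -/

/-- `A (φ(0)² + φ(1)²) ≤ B ∫ φ'² + C ∫ φ²` for all `C¹` functions `φ`. -/
def IntervalIneq (A B C : ℝ) : Prop :=
  ∀ φ φ' : ℝ → ℝ, (∀ s, HasDerivAt φ (φ' s) s) → Continuous φ' →
    A * (φ 0 ^ 2 + φ 1 ^ 2) ≤ B * (∫ s in (0 : ℝ)..1, φ' s ^ 2) + C * ∫ s in (0 : ℝ)..1, φ s ^ 2

theorem norm_sq_plane (v : Plane) : ‖v‖ ^ 2 = v 0 ^ 2 + v 1 ^ 2 := by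
  rw [EuclideanSpace.norm_sq_eq]; simp

theorem continuous_coord {G : Plane → Plane} (hG : Continuous G) (i : Fin 2) :
    Continuous fun x => G x i := by fun_prop

/-- Apply the interval inequality on every horizontal and every vertical line and integrate by
Fubini. Each family of lines uses only the derivative along it, so `B` occurs once, but both use `∫
φ²`, hence `2 * C`. -/
theorem IntervalIneq.integral_squareBdry_le {A B C : ℝ} (h : IntervalIneq A B C) {φ : Plane → ℝ}
    (hφ : ContDiff ℝ ∞ φ) :
    A * ∫ x, φ x ^ 2 ∂squareBdry
      ≤ B * (∫ x in square, ‖gradient φ x‖ ^ 2) + 2 * C * ∫ x in square, φ x ^ 2 := by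
  have cφ : Continuous fun x => φ x ^ 2 := hφ.continuous.pow 2
  have c0 : Continuous fun x => gradient φ x 0 ^ 2 :=
    (continuous_coord (continuous_gradient hφ) 0).pow 2
  have c1 : Continuous fun x => gradient φ x 1 ^ 2 :=
    (continuous_coord (continuous_gradient hφ) 1).pow 2
  have hc := compactlyCarried_restrict isBounded_square
  have cm : ∀ {F : Plane → ℝ}, Continuous F → (∀ x, Continuous fun s => F !₂[x, s]) ∧
      ∀ y, Continuous fun s => F !₂[s, y] := fun hF =>
    ⟨fun x => (hF.comp continuous_mk).comp (Continuous.prodMk_right x),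
      fun y => (hF.comp continuous_mk).comp (Continuous.prodMk_left y)⟩
  have ii : ∀ {f : ℝ → ℝ}, Continuous f → IntervalIntegrable f volume 0 1 :=
    fun hf => hf.intervalIntegrable 0 1
  have e : ∫ x in square, ‖gradient φ x‖ ^ 2
      = (∫ x in square, gradient φ x 0 ^ 2) + ∫ x in square, gradient φ x 1 ^ 2 := by
    rw [← integral_add (hc.integrable c0) (hc.integrable c1)]
    simp_rw [norm_sq_plane]
  have hx : A * ((∫ s in (0 : ℝ)..1, φ !₂[0, s] ^ 2) + ∫ s in (0 : ℝ)..1, φ !₂[1, s] ^ 2)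
      ≤ B * (∫ x in square, gradient φ x 0 ^ 2) + C * ∫ x in square, φ x ^ 2 := by
    rw [integral_square_swap c0, integral_square_swap cφ, ← intervalIntegral.integral_const_mul,
      ← intervalIntegral.integral_const_mul,
      ← intervalIntegral.integral_add (ii ((cm cφ).1 _)) (ii ((cm cφ).1 _)),
      ← intervalIntegral.integral_const_mul,
      ← intervalIntegral.integral_add ((ii (continuous_slice c0).1).const_mul _)
        ((ii (continuous_slice cφ).1).const_mul _)]
    refine intervalIntegral.integral_mono_on zero_le_one
      ((ii (((cm cφ).1 0).add ((cm cφ).1 1))).const_mul _)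
      (((ii (continuous_slice c0).1).const_mul _).add ((ii (continuous_slice cφ).1).const_mul _))
      fun y _ => ?_
    exact h (fun s => φ !₂[s, y]) (fun s => gradient φ !₂[s, y] 0)
      (fun s => (hasDerivAt_slice hφ s y).1)
      ((cm (continuous_coord (continuous_gradient hφ) 0)).2 y)
  have hy : A * ((∫ s in (0 : ℝ)..1, φ !₂[s, 0] ^ 2) + ∫ s in (0 : ℝ)..1, φ !₂[s, 1] ^ 2)
      ≤ B * (∫ x in square, gradient φ x 1 ^ 2) + C * ∫ x in square, φ x ^ 2 := by
    rw [integral_square c1, integral_square cφ, ← intervalIntegral.integral_const_mul,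
      ← intervalIntegral.integral_const_mul,
      ← intervalIntegral.integral_add (ii ((cm cφ).2 _)) (ii ((cm cφ).2 _)),
      ← intervalIntegral.integral_const_mul,
      ← intervalIntegral.integral_add ((ii (continuous_slice c1).2).const_mul _)
        ((ii (continuous_slice cφ).2).const_mul _)]
    refine intervalIntegral.integral_mono_on zero_le_one
      ((ii (((cm cφ).2 0).add ((cm cφ).2 1))).const_mul _)
      (((ii (continuous_slice c1).2).const_mul _).add ((ii (continuous_slice cφ).2).const_mul _))
      fun x _ => ?_
    exact h (fun s => φ !₂[x, s]) (fun s => gradient φ !₂[x, s] 1)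
      (fun s => (hasDerivAt_slice hφ x s).2)
      ((cm (continuous_coord (continuous_gradient hφ) 1)).1 x)
  rw [integral_squareBdry cφ, e]
  linarith

/-- The fundamental theorem of calculus for `φ² P`. Different weights `P` yield the Picone and the
trace inequality. -/
theorem integral_weighted {P P' φ φ' : ℝ → ℝ} (hP : ∀ s ∈ Set.Icc (0 : ℝ) 1, HasDerivAt P (P' s) s)
    (hP' : ContinuousOn P' (Set.Icc 0 1)) (hφ : ∀ s, HasDerivAt φ (φ' s) s)
    (hφ' : Continuous φ') :
    ∫ s in (0 : ℝ)..1, (2 * φ s * φ' s * P s + φ s ^ 2 * P' s) = φ 1 ^ 2 * P 1 - φ 0 ^ 2 * P 0 := by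
  have cφ : Continuous φ := continuous_iff_continuousAt.2 fun s => (hφ s).continuousAt
  have cP : ContinuousOn P (Set.Icc 0 1) := fun s hs => (hP s hs).continuousAt.continuousWithinAt
  refine intervalIntegral.integral_eq_sub_of_hasDerivAt (f := fun s => φ s ^ 2 * P s)
    (fun s hs => ?_) ?_
  · rw [Set.uIcc_of_le zero_le_one] at hs
    refine (((hφ s).pow 2).mul (hP s hs)).congr_deriv ?_
    simp
  · refine ContinuousOn.intervalIntegrable ?_
    rw [Set.uIcc_of_le zero_le_one]
    exact (((continuous_const.mul cφ).mul hφ').continuousOn.mul cP).add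
      ((cφ.pow 2).continuousOn.mul hP')

/-- The Picone inequality for a solution of the Riccati equation `P' + P² + κ = 0`. -/
theorem intervalIneq_of_riccati {P : ℝ → ℝ} {κ d : ℝ}
    (hP : ∀ s ∈ Set.Icc (0 : ℝ) 1, HasDerivAt P (-κ - P s ^ 2) s) (h0 : P 0 = -d) (h1 : P 1 = d) :
    IntervalIneq d 1 (-κ) := by
  intro φ φ' hφ hφ'
  have cφ : Continuous φ := continuous_iff_continuousAt.2 fun s => (hφ s).continuousAt
  have cP : ContinuousOn P (Set.Icc 0 1) := fun s hs => (hP s hs).continuousAt.continuousWithinAt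
  have key := integral_weighted hP (continuousOn_const.sub (cP.pow 2)) hφ hφ'
  have i1 : IntervalIntegrable (fun s => 1 * φ' s ^ 2 + -κ * φ s ^ 2) volume 0 1 :=
    Continuous.intervalIntegrable (by fun_prop) 0 1
  have : ∫ s in (0 : ℝ)..1, (2 * φ s * φ' s * P s + φ s ^ 2 * (-κ - P s ^ 2))
      ≤ ∫ s in (0 : ℝ)..1, (1 * φ' s ^ 2 + -κ * φ s ^ 2) := by
    refine intervalIntegral.integral_mono_on zero_le_one ?_ i1 fun s _ => ?_
    · refine ContinuousOn.intervalIntegrable ?_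
      rw [Set.uIcc_of_le zero_le_one]
      exact (((continuous_const.mul cφ).mul hφ').continuousOn.mul cP).add
        ((cφ.pow 2).continuousOn.mul (continuousOn_const.sub (cP.pow 2)))
    -- Picone: `(φ' - Pφ)² ≥ 0` says that `2φφ'P - P²φ² ≤ φ'²`.
    · nlinarith [sq_nonneg (φ' s - P s * φ s)]
  rw [key, intervalIntegral.integral_add (Continuous.intervalIntegrable (by fun_prop) 0 1)
    (Continuous.intervalIntegrable (by fun_prop) 0 1), intervalIntegral.integral_const_mul,
    intervalIntegral.integral_const_mul, h0, h1] at this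
  linarith

/-- The weight `2s - 1` equals `-1` and `1` at the ends, so the two boundary terms add up. Young's
inequality with parameter `t` then splits `2φφ'(2s - 1)`. -/
theorem intervalIneq_trace {t : ℝ} (ht : 0 < t) : IntervalIneq 1 t (2 + 1 / t) := by
  intro φ φ' hφ hφ'
  have cφ : Continuous φ := continuous_iff_continuousAt.2 fun s => (hφ s).continuousAt
  have key := integral_weighted (P := fun s => 2 * s - 1) (P' := fun _ => 2)
    (fun s _ => by simpa using ((hasDerivAt_id' s).const_mul 2).sub_const 1)
    continuousOn_const hφ hφ'
  have : ∫ s in (0 : ℝ)..1, (2 * φ s * φ' s * (2 * s - 1) + φ s ^ 2 * 2)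
      ≤ ∫ s in (0 : ℝ)..1, (t * φ' s ^ 2 + (2 + 1 / t) * φ s ^ 2) := by
    refine intervalIntegral.integral_mono_on zero_le_one
      (Continuous.intervalIntegrable (by fun_prop) 0 1)
      (Continuous.intervalIntegrable (by fun_prop) 0 1) fun s hs => ?_
    have e : t * φ' s ^ 2 + 1 / t * φ s ^ 2 - 2 * φ s * φ' s * (2 * s - 1)
        = t * (φ' s - (2 * s - 1) / t * φ s) ^ 2 + 1 / t * (1 - (2 * s - 1) ^ 2) * φ s ^ 2 := by
      field_simp; ring
    have p : 0 ≤ 1 - (2 * s - 1) ^ 2 := by nlinarith [hs.1, hs.2]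
    have : 0 ≤ t * φ' s ^ 2 + 1 / t * φ s ^ 2 - 2 * φ s * φ' s * (2 * s - 1) := by
      rw [e]; positivity
    linarith
  rw [key, intervalIntegral.integral_add (Continuous.intervalIntegrable (by fun_prop) 0 1)
    (Continuous.intervalIntegrable (by fun_prop) 0 1), intervalIntegral.integral_const_mul,
    intervalIntegral.integral_const_mul] at this
  linarith

/-- The first Robin eigenfunction of the unit interval. -/
theorem exists_robin_interval (d : ℝ) : ∃ (X : ℝ → ℝ) (κ : ℝ), ContDiff ℝ ∞ X ∧
    (∀ s, HasDerivAt (deriv X) (-κ * X s) s) ∧ (∀ s ∈ Set.Icc (0 : ℝ) 1, 0 < X s) ∧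
    deriv X 0 = -d * X 0 ∧ deriv X 1 = d * X 1 := by
  rcases le_or_gt 0 d with hd | hd
  -- For `d ≥ 0` take `cosh(k(s - 1/2))` and `κ = -k²`. By symmetry both boundary conditions reduce
  -- to `k sinh(k/2) = d cosh(k/2)`, solved by the intermediate value theorem; at `k = 2d + 2` the
  -- bound `cosh ≤ 2 sinh` gives the sign.
  · obtain ⟨k, -, hk⟩ : (0 : ℝ) ∈ (fun k => k * Real.sinh (k / 2) - d * Real.cosh (k / 2)) ''
        Set.Icc 0 (2 * d + 2) := by
      refine intermediate_value_Icc (by linarith)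
        (Continuous.continuousOn (by fun_prop)) ⟨by simpa, ?_⟩
      have e : (2 * d + 2) / 2 = d + 1 := by ring
      rw [e]
      have h1 : Real.cosh (d + 1) ≤ 2 * Real.sinh (d + 1) := by
        rw [Real.cosh_eq, Real.sinh_eq, Real.exp_neg]
        have h2 : 2 ≤ Real.exp (d + 1) := by linarith [Real.add_one_le_exp (d + 1)]
        have h3 : (Real.exp (d + 1))⁻¹ ≤ 1 / 2 := by
          rw [inv_le_comm₀ (by positivity) (by norm_num)]; linarith
        linarith
      nlinarith [Real.cosh_pos (d + 1)]
    have hl : ∀ s, HasDerivAt (fun s => k * (s - 1 / 2)) k s := fun s => by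
      simpa only [mul_one] using ((hasDerivAt_id' s).sub_const (1 / 2)).const_mul k
    have hX : ∀ s, HasDerivAt (fun s => Real.cosh (k * (s - 1 / 2)))
        (Real.sinh (k * (s - 1 / 2)) * k) s := fun s => (hl s).cosh
    have hX' : deriv (fun s => Real.cosh (k * (s - 1 / 2)))
        = fun s => Real.sinh (k * (s - 1 / 2)) * k := funext fun s => (hX s).deriv
    have e0 : k * (0 - 1 / 2) = -(k / 2) := by ring
    have e1 : k * (1 - 1 / 2) = k / 2 := by ring
    refine ⟨fun s => Real.cosh (k * (s - 1 / 2)), -k ^ 2,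
      Real.contDiff_cosh.comp (by fun_prop), fun s => ?_,
      fun s _ => Real.cosh_pos _, ?_, ?_⟩
    · rw [hX']
      exact ((hl s).sinh.mul_const k).congr_deriv (by ring)
    · rw [hX']
      simp only [e0, Real.sinh_neg, Real.cosh_neg]
      linarith
    · rw [hX']
      simp only [e1]
      linarith
  -- For `d < 0` take `cos(k(s - 1/2))` and `κ = k²`. The open interval `0 < k < π` keeps the
  -- argument within `(-π/2, π/2)`, hence the cosine positive.
  · obtain ⟨k, hk0, hk⟩ : (0 : ℝ) ∈ (fun k => k * Real.sin (k / 2) + d * Real.cos (k / 2)) ''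
        Set.Ioo 0 Real.pi := by
      refine intermediate_value_Ioo Real.pi_pos.le
        (Continuous.continuousOn (by fun_prop)) ⟨by simpa, ?_⟩
      simpa using Real.pi_pos
    have hl : ∀ s, HasDerivAt (fun s => k * (s - 1 / 2)) k s := fun s => by
      simpa only [mul_one] using ((hasDerivAt_id' s).sub_const (1 / 2)).const_mul k
    have hX : ∀ s, HasDerivAt (fun s => Real.cos (k * (s - 1 / 2)))
        (-Real.sin (k * (s - 1 / 2)) * k) s := fun s => (hl s).cos
    have hX' : deriv (fun s => Real.cos (k * (s - 1 / 2)))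
        = fun s => -Real.sin (k * (s - 1 / 2)) * k := funext fun s => (hX s).deriv
    have e0 : k * (0 - 1 / 2) = -(k / 2) := by ring
    have e1 : k * (1 - 1 / 2) = k / 2 := by ring
    refine ⟨fun s => Real.cos (k * (s - 1 / 2)), k ^ 2,
      Real.contDiff_cos.comp (by fun_prop), fun s => ?_,
      fun s hs => Real.cos_pos_of_mem_Ioo ⟨?_, ?_⟩, ?_, ?_⟩
    · rw [hX']
      exact ((hl s).sin.neg.mul_const k).congr_deriv (by ring)
    · nlinarith [hs.1, hs.2, hk0.1, hk0.2]
    · nlinarith [hs.1, hs.2, hk0.1, hk0.2]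
    · rw [hX']
      simp only [e0, Real.sin_neg, Real.cos_neg]
      linarith
    · rw [hX']
      simp only [e1]
      linarith

/-- The logarithmic derivative `X'/X` of a positive solution satisfies the Riccati equation, and the
Robin conditions give its end values. -/
theorem intervalIneq_robin {X : ℝ → ℝ} {κ d : ℝ} (hX : ContDiff ℝ ∞ X)
    (hX' : ∀ s, HasDerivAt (deriv X) (-κ * X s) s) (hpos : ∀ s ∈ Set.Icc (0 : ℝ) 1, 0 < X s)
    (h0 : deriv X 0 = -d * X 0) (h1 : deriv X 1 = d * X 1) : IntervalIneq d 1 (-κ) := by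
  refine intervalIneq_of_riccati (P := fun s => deriv X s / X s) (fun s hs => ?_) ?_ ?_
  · have hs' := (hpos s hs).ne'
    refine ((hX' s).div ((hX.differentiable (by simp)).differentiableAt.hasDerivAt) hs').congr_deriv ?_
    field_simp
  · rw [h0, mul_div_cancel_right₀ _ (hpos 0 (by simp)).ne']
  · rw [h1, mul_div_cancel_right₀ _ (hpos 1 (by simp)).ne']

/-! ### The first Robin eigenvalue of the square -/

/-- Weak form of the eigenvalue problem on the interval: integrate `(X'φ)'` and insert the boundary
conditions. -/
theorem integral_deriv_mul_deriv {X φ φ' : ℝ → ℝ} {κ d : ℝ} (hX : ContDiff ℝ ∞ X)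
    (hX' : ∀ s, HasDerivAt (deriv X) (-κ * X s) s)
    (h0 : deriv X 0 = -d * X 0) (h1 : deriv X 1 = d * X 1)
    (hφ : ∀ s, HasDerivAt φ (φ' s) s) (hφ' : Continuous φ') :
    ∫ s in (0 : ℝ)..1, deriv X s * φ' s
      = d * (X 0 * φ 0 + X 1 * φ 1) + κ * ∫ s in (0 : ℝ)..1, X s * φ s := by
  have cφ : Continuous φ := continuous_iff_continuousAt.2 fun s => (hφ s).continuousAt
  have cX := hX.continuous
  have cX' : Continuous (deriv X) := hX.continuous_deriv (by simp)
  have := intervalIntegral.integral_eq_sub_of_hasDerivAt (a := 0) (b := 1)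
    (fun s _ => (hX' s).mul (hφ s)) (Continuous.intervalIntegrable (by fun_prop) _ _)
  rw [intervalIntegral.integral_add (Continuous.intervalIntegrable (by fun_prop) _ _)
    (Continuous.intervalIntegrable (by fun_prop) _ _)] at this
  simp only [mul_assoc, intervalIntegral.integral_const_mul, Pi.mul_apply, h0, h1] at this
  linarith

/-- The product `(x, y) ↦ X(x) X(y)`. -/
def tensorSquare (X : ℝ → ℝ) (x : Plane) : ℝ := X (x 0) * X (x 1)

theorem contDiff_coord {n : WithTop ℕ∞} (i : Fin 2) : ContDiff ℝ n fun x : Plane => x i := by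
  fun_prop

theorem contDiff_tensorSquare {X : ℝ → ℝ} (hX : ContDiff ℝ ∞ X) :
    ContDiff ℝ ∞ (tensorSquare X) :=
  (hX.comp (contDiff_coord 0)).mul (hX.comp (contDiff_coord 1))

theorem gradient_tensorSquare {X : ℝ → ℝ} (hX : ContDiff ℝ ∞ X) (x y : ℝ) :
    gradient (tensorSquare X) !₂[x, y] 0 = deriv X x * X y ∧
      gradient (tensorSquare X) !₂[x, y] 1 = X x * deriv X y := by
  have d := fun s => (hX.differentiable (by simp)).differentiableAt.hasDerivAt (x := s)
  obtain ⟨h0, h1⟩ := hasDerivAt_slice (contDiff_tensorSquare hX) x y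
  exact ⟨h0.unique ((d x).mul_const (X y)), h1.unique ((d y).const_mul (X x))⟩

theorem inner_plane (v w : Plane) : inner ℝ v w = v 0 * w 0 + v 1 * w 1 := by
  rw [PiLp.inner_apply, Fin.sum_univ_two]; simp [mul_comm]

/-- Separation of variables: the interval identity is applied along each line, the other factor
being constant there. Each direction contributes one `κ` and two of the four sides. -/
theorem integral_gradient_tensorSquare {X : ℝ → ℝ} {κ d : ℝ} (hX : ContDiff ℝ ∞ X)
    (hX' : ∀ s, HasDerivAt (deriv X) (-κ * X s) s)
    (h0 : deriv X 0 = -d * X 0) (h1 : deriv X 1 = d * X 1) {φ : Plane → ℝ}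
    (hφ : ContDiff ℝ ∞ φ) :
    ∫ x in square, inner ℝ (gradient (tensorSquare X) x) (gradient φ x)
      = d * (∫ x, tensorSquare X x * φ x ∂squareBdry)
        + 2 * κ * ∫ x in square, tensorSquare X x * φ x := by
  have hu := contDiff_tensorSquare hX
  have cX := hX.continuous
  have cφ := hφ.continuous
  have cg := continuous_gradient hφ
  have cu := hu.continuous
  have cgu := continuous_gradient hu
  have cp : Continuous fun x => tensorSquare X x * φ x := cu.mul cφ
  have c0 : Continuous fun x => gradient (tensorSquare X) x 0 * gradient φ x 0 := by fun_prop
  have c1 : Continuous fun x => gradient (tensorSquare X) x 1 * gradient φ x 1 := by fun_prop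
  have hc := compactlyCarried_restrict isBounded_square
  have cm : ∀ {F : Plane → ℝ}, Continuous F → (∀ x, Continuous fun s => F !₂[x, s]) ∧
      ∀ y, Continuous fun s => F !₂[s, y] := fun hF =>
    ⟨fun x => (hF.comp continuous_mk).comp (Continuous.prodMk_right x),
      fun y => (hF.comp continuous_mk).comp (Continuous.prodMk_left y)⟩
  have ii : ∀ {f : ℝ → ℝ}, Continuous f → IntervalIntegrable f volume 0 1 :=
    fun hf => hf.intervalIntegrable 0 1
  have e : ∫ x in square, inner ℝ (gradient (tensorSquare X) x) (gradient φ x)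
      = (∫ x in square, gradient (tensorSquare X) x 0 * gradient φ x 0)
        + ∫ x in square, gradient (tensorSquare X) x 1 * gradient φ x 1 := by
    rw [← integral_add (hc.integrable c0) (hc.integrable c1)]
    simp_rw [inner_plane]
  have hx : ∫ x in square, gradient (tensorSquare X) x 0 * gradient φ x 0
      = d * ((∫ s in (0 : ℝ)..1, tensorSquare X !₂[0, s] * φ !₂[0, s])
          + ∫ s in (0 : ℝ)..1, tensorSquare X !₂[1, s] * φ !₂[1, s])
        + κ * ∫ x in square, tensorSquare X x * φ x := by
    rw [integral_square_swap c0, integral_square_swap cp, ← intervalIntegral.integral_const_mul,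
      ← intervalIntegral.integral_add (ii ((cm cp).1 _)) (ii ((cm cp).1 _)),
      ← intervalIntegral.integral_const_mul,
      ← intervalIntegral.integral_add
        (ii (show Continuous fun s => d * (tensorSquare X !₂[0, s] * φ !₂[0, s]
          + tensorSquare X !₂[1, s] * φ !₂[1, s]) from
            continuous_const.mul (((cm cp).1 0).add ((cm cp).1 1))))
        ((ii (continuous_slice cp).1).const_mul _)]
    refine intervalIntegral.integral_congr fun y _ => ?_
    have := integral_deriv_mul_deriv hX hX' h0 h1 (fun s => (hasDerivAt_slice hφ s y).1)
      ((cm (continuous_coord cg 0)).2 y)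
    calc ∫ x in (0 : ℝ)..1, gradient (tensorSquare X) !₂[x, y] 0 * gradient φ !₂[x, y] 0
        = ∫ x in (0 : ℝ)..1, X y * (deriv X x * gradient φ !₂[x, y] 0) := by
          simp_rw [(gradient_tensorSquare hX _ _).1]
          exact intervalIntegral.integral_congr fun x _ => by ring
      _ = X y * (d * (X 0 * φ !₂[0, y] + X 1 * φ !₂[1, y])
            + κ * ∫ s in (0 : ℝ)..1, X s * φ !₂[s, y]) := by
          rw [intervalIntegral.integral_const_mul, this]
      _ = d * (X 0 * X y * φ !₂[0, y] + X 1 * X y * φ !₂[1, y])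
            + κ * ∫ s in (0 : ℝ)..1, X y * (X s * φ !₂[s, y]) := by
          rw [intervalIntegral.integral_const_mul]; ring
      _ = _ := by
          congr 2
          exact intervalIntegral.integral_congr fun x _ => by simp [tensorSquare]; ring
  have hy : ∫ x in square, gradient (tensorSquare X) x 1 * gradient φ x 1
      = d * ((∫ s in (0 : ℝ)..1, tensorSquare X !₂[s, 0] * φ !₂[s, 0])
          + ∫ s in (0 : ℝ)..1, tensorSquare X !₂[s, 1] * φ !₂[s, 1])
        + κ * ∫ x in square, tensorSquare X x * φ x := by
    rw [integral_square c1, integral_square cp, ← intervalIntegral.integral_const_mul,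
      ← intervalIntegral.integral_add (ii ((cm cp).2 _)) (ii ((cm cp).2 _)),
      ← intervalIntegral.integral_const_mul,
      ← intervalIntegral.integral_add
        (ii (show Continuous fun s => d * (tensorSquare X !₂[s, 0] * φ !₂[s, 0]
          + tensorSquare X !₂[s, 1] * φ !₂[s, 1]) from
            continuous_const.mul (((cm cp).2 0).add ((cm cp).2 1))))
        ((ii (continuous_slice cp).2).const_mul _)]
    refine intervalIntegral.integral_congr fun x _ => ?_
    have := integral_deriv_mul_deriv hX hX' h0 h1 (fun s => (hasDerivAt_slice hφ x s).2)
      ((cm (continuous_coord cg 1)).1 x)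
    calc ∫ y in (0 : ℝ)..1, gradient (tensorSquare X) !₂[x, y] 1 * gradient φ !₂[x, y] 1
        = ∫ y in (0 : ℝ)..1, X x * (deriv X y * gradient φ !₂[x, y] 1) := by
          simp_rw [(gradient_tensorSquare hX _ _).2]
          exact intervalIntegral.integral_congr fun y _ => by ring
      _ = X x * (d * (X 0 * φ !₂[x, 0] + X 1 * φ !₂[x, 1])
            + κ * ∫ s in (0 : ℝ)..1, X s * φ !₂[x, s]) := by
          rw [intervalIntegral.integral_const_mul, this]
      _ = d * (X x * X 0 * φ !₂[x, 0] + X x * X 1 * φ !₂[x, 1])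
            + κ * ∫ s in (0 : ℝ)..1, X x * (X s * φ !₂[x, s]) := by
          rw [intervalIntegral.integral_const_mul]; ring
      _ = _ := by
          congr 2
          exact intervalIntegral.integral_congr fun y _ => by simp [tensorSquare]; ring
  rw [e, hx, hy, integral_squareBdry cp]
  ring

theorem isRobinEigenvalue_tensorSquare {X : ℝ → ℝ} {κ d : ℝ} (hX : ContDiff ℝ ∞ X)
    (hX' : ∀ s, HasDerivAt (deriv X) (-κ * X s) s) (hpos : ∀ s ∈ Set.Icc (0 : ℝ) 1, 0 < X s)
    (h0 : deriv X 0 = -d * X 0) (h1 : deriv X 1 = d * X 1) (a c : ℝ) :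
    IsRobinEigenvalue a c d (2 * κ + (a - c)) := by
  have hu := contDiff_tensorSquare hX
  have hA := H1Approx.of_contDiff isBounded_square compactlyCarried_squareBdry hu
  refine ⟨tensorSquare X, tensorSquare X, hA.memH1 isBounded_square,
    hA.isTrace isOpen_square isBounded_square, fun h => ?_, fun ψ χ _ hψ => ?_⟩
  · have h2 : ∀ᵐ x ∂volume, x ∉ square := by
      rw [EventuallyEq, ae_restrict_iff' isOpen_square.measurableSet] at h
      filter_upwards [h] with x hx hxs
      have : 0 < tensorSquare X x :=
        mul_pos (hpos _ ⟨hxs.1.le, hxs.2.1.le⟩) (hpos _ ⟨hxs.2.2.1.le, hxs.2.2.2.le⟩)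
      exact this.ne' (hx hxs)
    have h3 : volume square = 0 := by
      rw [← compl_mem_ae_iff]; exact h2
    refine (isOpen_square.measure_pos volume ⟨!₂[1 / 2, 1 / 2], ?_⟩).ne' h3
    norm_num [square]
  · have hB := hψ.h1Approx isOpen_square isBounded_square
    -- The identity is known for smooth `φ`; all its terms are continuous along the sequence
    -- defining the trace of `ψ`.
    obtain ⟨φ, hφ, t1, t2, t3⟩ := hB.exists_seq
    have hc := compactlyCarried_restrict isBounded_square
    have hσ := compactlyCarried_squareBdry
    have l1 := tendsto_integral_inner (fun n => hc.memLp (hφ n).continuous 2)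
      (fun _ => hA.memLp) hB.memLp hA.memLp t1 (by simp)
    have l2 := tendsto_integral_inner (fun _ => hA.memLp_grad)
      (fun n => hc.memLp (continuous_gradient (hφ n)) 2) hA.memLp_grad hB.memLp_grad (by simp) t2
    have l3 := tendsto_integral_inner (fun n => hσ.memLp (hφ n).continuous 2)
      (fun _ => hA.memLp_trace) hB.memLp_trace hA.memLp_trace t3 (by simp)
    simp only [RCLike.inner_apply, conj_trivial] at l1 l3
    have := tendsto_nhds_unique l2
      (((l3.const_mul d).add (l1.const_mul (2 * κ))).congr fun n =>
        (integral_gradient_tensorSquare hX hX' h0 h1 (hφ n)).symm)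
    have e : ∫ x in square, inner ℝ (weakGrad square (tensorSquare X) x) (weakGrad square ψ x)
        = ∫ x in square, inner ℝ (gradient (tensorSquare X) x) (weakGrad square ψ x) := by
      refine integral_congr_ae ?_
      filter_upwards [hA.weakGrad_ae_eq isOpen_square isBounded_square] with x hx
      rw [hx]
    rw [e, this]
    ring

/-- Here `E`, `N`, `S` stand for `∫|∇u|²`, `∫u²` and the boundary integral of `u²`. The spectral
bound `l * N ≤ Q` alone does not control `E`; the trace inequality gives `E / 2 - C * N ≤ Q`, and a
convex combination of the two controls both. -/
theorem exists_coercivity_const {b d l : ℝ} (hl : 0 < l) :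
    ∃ t > 0, ∃ c > 0, ∀ E N S : ℝ, 0 ≤ E → 0 ≤ N → 0 ≤ S → l * N ≤ E + b * N - d * S →
      S ≤ t * E + 2 * (2 + 1 / t) * N → S ≤ E + 6 * N →
      c * (E + N + S) ≤ E + b * N - d * S := by
  -- Small enough that the boundary term absorbs at most half of `E`.
  set t := 1 / (2 * (|d| + 1)) with ht
  have ht0 : 0 < t := by positivity
  have hdt : |d| * t ≤ 1 / 2 := by
    rw [ht, mul_one_div, div_le_div_iff₀ (by positivity) (by norm_num)]
    linarith
  set C := |b| + |d| * (2 * (2 + 1 / t)) with hC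
  have hC0 : 0 ≤ C := by positivity
  -- The weight of the combination: the coefficient of `N` becomes `(1 - s) l - s C = l / 2`.
  set s := l / (2 * (l + C)) with hs
  have hs0 : 0 < s := by positivity
  have hsl : s * (l + C) = l / 2 := by rw [hs]; field_simp
  have hs1 : s ≤ 1 := by
    rw [hs, div_le_one (by positivity)]; linarith
  set m := min (s / 2) (l / 2) with hm
  have hm0 : 0 < m := by positivity
  -- The `7` comes from `E + N + S ≤ 2E + 7N ≤ 7(E + N)`.
  refine ⟨t, ht0, m / 7, by positivity, fun E N S hE hN hS h1 h2 h3 => ?_⟩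
  set Q := E + b * N - d * S with hQ
  have q1 : E / 2 - C * N ≤ Q := by
    have a1 : -(|b| * N) ≤ b * N := by nlinarith [neg_abs_le b]
    have a2 : d * S ≤ |d| * S := by nlinarith [le_abs_self d]
    have a3 : |d| * S ≤ |d| * (t * E + 2 * (2 + 1 / t) * N) :=
      mul_le_mul_of_nonneg_left h2 (abs_nonneg d)
    have a4 : |d| * t * E ≤ 1 / 2 * E := mul_le_mul_of_nonneg_right hdt hE
    have a5 : C * N = |b| * N + |d| * (2 * (2 + 1 / t) * N) := by rw [hC]; ring
    linarith
  have q2 : s / 2 * E + l / 2 * N ≤ Q := by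
    have a1 := mul_le_mul_of_nonneg_left q1 hs0.le
    have a2 := mul_le_mul_of_nonneg_left h1 (sub_nonneg.2 hs1)
    have a3 : (s * (l + C)) * N = l / 2 * N := by rw [hsl]
    nlinarith
  have q3 : m * E ≤ s / 2 * E := mul_le_mul_of_nonneg_right (min_le_left _ _) hE
  have q4 : m * N ≤ l / 2 * N := mul_le_mul_of_nonneg_right (min_le_right _ _) hN
  nlinarith [mul_le_mul_of_nonneg_left h3 hm0.le, mul_nonneg hm0.le hE]

/-- Positivity of the first Robin eigenvalue implies coercivity of the Robin form. -/
theorem exists_coercive {a c₀ d₀ μ₁ : ℝ} (hμ₁ : IsLeast {μ : ℝ | IsRobinEigenvalue a c₀ d₀ μ} μ₁)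
    (hpos : 0 < μ₁) :
    ∃ c > 0, ∀ u G w, H1Approx square squareBdry u G w →
      c * ((∫ x in square, ‖G x‖ ^ 2) + (∫ x in square, u x ^ 2) + ∫ x, w x ^ 2 ∂squareBdry)
        ≤ (∫ x in square, ‖G x‖ ^ 2) + (a - c₀) * (∫ x in square, u x ^ 2)
          - d₀ * ∫ x, w x ^ 2 ∂squareBdry := by
  obtain ⟨X, κ, hX, hX', hXpos, h0, h1⟩ := exists_robin_interval d₀
  -- Minimality of `μ₁` enters only here, against one explicit eigenvalue.
  have hl : 0 < 2 * κ + (a - c₀) :=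
    hpos.trans_le (hμ₁.2 (isRobinEigenvalue_tensorSquare hX hX' hXpos h0 h1 a c₀))
  obtain ⟨t, ht, c, hc0, key⟩ := exists_coercivity_const (b := a - c₀) (d := d₀) hl
  refine ⟨c, hc0, fun u G w h => ?_⟩
  obtain ⟨φ, hφ, t1, t2, t3⟩ := h.exists_seq
  have hc := compactlyCarried_restrict isBounded_square
  have hσ := compactlyCarried_squareBdry
  have l1 := tendsto_integral_norm_sq (fun n => hc.memLp (hφ n).continuous 2) h.memLp t1
  have l2 := tendsto_integral_norm_sq (fun n => hc.memLp (continuous_gradient (hφ n)) 2)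
    h.memLp_grad t2
  have l3 := tendsto_integral_norm_sq (fun n => hσ.memLp (hφ n).continuous 2) h.memLp_trace t3
  simp only [Real.norm_eq_abs, sq_abs] at l1 l3
  refine le_of_tendsto_of_tendsto' (((l2.add l1).add l3).const_mul c)
    ((l2.add (l1.const_mul _)).sub (l3.const_mul _)) fun n => ?_
  refine key _ _ _ (by positivity) (by positivity) (by positivity) ?_ ?_ ?_
  · have := (intervalIneq_robin hX hX' hXpos h0 h1).integral_squareBdry_le (hφ n)
    linarith
  · have := (intervalIneq_trace ht).integral_squareBdry_le (hφ n)
    linarith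
  · have := (intervalIneq_trace one_pos).integral_squareBdry_le (hφ n)
    norm_num at this
    linarith

/-! ### Logarithmic truncations and the energy estimate -/

theorem exists_bound_deriv_smoothTransition :
    ∃ M, 0 ≤ M ∧ ∀ t, |deriv Real.smoothTransition t| ≤ M := by
  have hc : Continuous (deriv Real.smoothTransition) :=
    (Real.smoothTransition.contDiff (n := 1)).continuous_deriv le_rfl
  obtain ⟨M, hM⟩ := isCompact_Icc.exists_bound_of_continuousOn (s := Set.Icc (0 : ℝ) 1)
    hc.continuousOn
  refine ⟨M, (norm_nonneg _).trans (hM 0 (by simp)), fun t => ?_⟩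
  by_cases h0 : 0 ≤ t
  · by_cases h1 : t ≤ 1
    · exact hM t ⟨h0, h1⟩
    · have : Real.smoothTransition =ᶠ[𝓝 t] fun _ => 1 := by
        filter_upwards [lt_mem_nhds (not_le.1 h1)] with s hs
        exact Real.smoothTransition.one_of_one_le hs.le
      rw [this.deriv_eq]
      simpa using (norm_nonneg _).trans (hM 0 (by simp))
  · have : Real.smoothTransition =ᶠ[𝓝 t] fun _ => 0 := by
      filter_upwards [gt_mem_nhds (not_le.1 h0)] with s hs
      exact Real.smoothTransition.zero_of_nonpos hs.le
    rw [this.deriv_eq]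
    simpa using (norm_nonneg _).trans (hM 0 (by simp))

/-- A cutoff function that decays on a logarithmic scale. -/
def logCutoff (n : ℕ) (s : ℝ) : ℝ := Real.smoothTransition (2 - Real.log (1 + s ^ 2) / (n + 1))

theorem contDiff_logCutoff (n : ℕ) : ContDiff ℝ ∞ (logCutoff n) := by
  refine Real.smoothTransition.contDiff.comp (contDiff_const.sub (ContDiff.div_const ?_ _))
  exact ContDiff.log (by fun_prop) fun s => by positivity

theorem logCutoff_nonneg (n : ℕ) (s : ℝ) : 0 ≤ logCutoff n s := Real.smoothTransition.nonneg _

theorem logCutoff_le_one (n : ℕ) (s : ℝ) : logCutoff n s ≤ 1 := Real.smoothTransition.le_one _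

theorem tendsto_logCutoff (s : ℝ) : Tendsto (fun n => logCutoff n s) atTop (𝓝 1) := by
  refine tendsto_const_nhds.congr' ?_
  obtain ⟨N, hN⟩ := exists_nat_ge (Real.log (1 + s ^ 2))
  filter_upwards [eventually_ge_atTop N] with n hn
  refine (Real.smoothTransition.one_of_one_le ?_).symm
  have : Real.log (1 + s ^ 2) / (n + 1) ≤ 1 := by
    rw [div_le_one (by positivity)]
    have : (N : ℝ) ≤ n := by exact_mod_cast hn
    linarith
  linarith

theorem logCutoff_eq_zero {n : ℕ} {s : ℝ} (hs : Real.exp (n + 1) ≤ |s|) : logCutoff n s = 0 := by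
  refine Real.smoothTransition.zero_of_nonpos ?_
  have h1 : Real.exp (2 * (n + 1)) ≤ 1 + s ^ 2 := by
    rw [two_mul, Real.exp_add, ← sq_abs]
    nlinarith [Real.exp_pos ((n : ℝ) + 1)]
  have h2 : 2 * ((n : ℝ) + 1) ≤ Real.log (1 + s ^ 2) :=
    (Real.le_log_iff_exp_le (by positivity)).2 h1
  have : 2 ≤ Real.log (1 + s ^ 2) / (n + 1) := by
    rwa [le_div_iff₀ (by positivity)]
  linarith

/-- This is the reason for the logarithm: `s (log(1 + s²))' = 2s²/(1 + s²) ≤ 2`, so dividing the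
logarithm by `n + 1` makes `s ρₙ'(s)` uniformly small. -/
theorem exists_bound_deriv_logCutoff :
    ∃ C, 0 ≤ C ∧ ∀ n s, |s * deriv (logCutoff n) s| ≤ C / (n + 1) := by
  obtain ⟨M, hM0, hM⟩ := exists_bound_deriv_smoothTransition
  refine ⟨2 * M, by positivity, fun n s => ?_⟩
  have hp : 0 < 1 + s ^ 2 := by positivity
  have h1 : HasDerivAt (fun s : ℝ => 2 - Real.log (1 + s ^ 2) / (n + 1))
      (-(2 * s / (1 + s ^ 2) / (n + 1))) s := by
    refine ((((hasDerivAt_pow 2 s).const_add 1).log hp.ne').div_const _).const_sub 2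
      |>.congr_deriv (by simp)
  have h2 : HasDerivAt (logCutoff n) _ s :=
    ((Real.smoothTransition.contDiff (n := 1)).differentiable
      (by simp)).differentiableAt.hasDerivAt.comp s h1
  rw [h2.deriv]
  have e : s * (deriv Real.smoothTransition (2 - Real.log (1 + s ^ 2) / (n + 1))
        * -(2 * s / (1 + s ^ 2) / (n + 1)))
      = -deriv Real.smoothTransition (2 - Real.log (1 + s ^ 2) / (n + 1))
        * (2 * s ^ 2 / (1 + s ^ 2)) / (n + 1) := by
    field_simp
  rw [e, abs_div, abs_mul, abs_neg, abs_of_pos (by positivity : (0 : ℝ) < n + 1),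
    abs_of_nonneg (by positivity : 0 ≤ 2 * s ^ 2 / (1 + s ^ 2)), mul_comm 2 M]
  gcongr
  · exact hM _
  · rw [div_le_iff₀ hp]; linarith

/-- The truncation `s ↦ s ρ(s)`. -/
def logTrunc (n : ℕ) (s : ℝ) : ℝ := s * logCutoff n s

theorem contDiff_logTrunc (n : ℕ) : ContDiff ℝ ∞ (logTrunc n) :=
  contDiff_id.mul (contDiff_logCutoff n)

theorem deriv_logTrunc (n : ℕ) (s : ℝ) :
    deriv (logTrunc n) s = logCutoff n s + s * deriv (logCutoff n) s := by
  have := (hasDerivAt_id' s).mul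
    (((contDiff_logCutoff n).differentiable (by simp)).differentiableAt (x := s)).hasDerivAt
  rw [one_mul] at this
  exact this.deriv

/-- The upper bound makes the truncation admissible in the chain rule; the lower one limits the loss
in the gradient term to a share `C / (n + 1)`. -/
theorem exists_bound_deriv_logTrunc : ∃ C, 0 ≤ C ∧
    (∀ n s, |deriv (logTrunc n) s| ≤ 1 + C) ∧
    ∀ n s, logCutoff n s - C / (n + 1) ≤ deriv (logTrunc n) s := by
  obtain ⟨C, hC0, hC⟩ := exists_bound_deriv_logCutoff
  refine ⟨C, hC0, fun n s => ?_, fun n s => ?_⟩ <;> rw [deriv_logTrunc]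
  · have h1 := hC n s
    have h2 : C / ((n : ℝ) + 1) ≤ C := div_le_self hC0 (by simp)
    have h3 := abs_add_le (logCutoff n s) (s * deriv (logCutoff n) s)
    rw [abs_of_nonneg (logCutoff_nonneg n s)] at h3
    linarith [logCutoff_le_one n s]
  · linarith [neg_le_of_abs_le (hC n s)]

/-- The truncation has compact support, so the product is bounded whatever the growth of `f`. -/
theorem exists_bound_mul_logTrunc {f : ℝ → ℝ} (hf : Continuous f) (n : ℕ) :
    ∃ C, ∀ s, ‖f s * logTrunc n s‖ ≤ C := by
  have hc : HasCompactSupport fun s => f s * logTrunc n s := by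
    refine HasCompactSupport.intro (isCompact_Icc (a := -Real.exp (n + 1)) (b := Real.exp (n + 1)))
      fun s hs => ?_
    rw [logTrunc, logCutoff_eq_zero, mul_zero, mul_zero]
    by_contra h
    exact hs (abs_le.1 (not_le.1 h).le)
  exact hc.exists_bound_of_continuous (hf.mul (contDiff_logTrunc n).continuous)

section Energy

variable {μ : Measure Plane}

theorem tendsto_integral_logCutoff {u F : Plane → ℝ} (hu : AEStronglyMeasurable u μ)
    (hF : Integrable F μ) :
    Tendsto (fun n => ∫ x, logCutoff n (u x) * F x ∂μ) atTop (𝓝 (∫ x, F x ∂μ)) := by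
  refine tendsto_integral_of_dominated_convergence (fun x => ‖F x‖)
    (fun n => ((contDiff_logCutoff n).continuous.comp_aestronglyMeasurable hu).mul hF.1) hF.norm
    (fun n => Eventually.of_forall fun x => ?_) (Eventually.of_forall fun x => ?_)
  · rw [norm_mul, Real.norm_of_nonneg (logCutoff_nonneg n _)]
    exact mul_le_of_le_one_left (norm_nonneg _) (logCutoff_le_one n _)
  · simpa using (tendsto_logCutoff (u x)).mul_const (F x)

theorem integrable_logCutoff_mul {u F : Plane → ℝ} (hu : AEStronglyMeasurable u μ)
    (hF : Integrable F μ) (n : ℕ) : Integrable (fun x => logCutoff n (u x) * F x) μ :=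
  hF.bdd_mul ((contDiff_logCutoff n).continuous.comp_aestronglyMeasurable hu) (c := 1)
    (Eventually.of_forall fun x => by
      rw [Real.norm_of_nonneg (logCutoff_nonneg n _)]; exact logCutoff_le_one n _)

theorem integrable_sq_mul {u j : Plane → ℝ} {M : ℝ} (hu : MemLp u 2 μ)
    (hj : AEStronglyMeasurable j μ) (hjM : ∀ᵐ x ∂μ, 0 ≤ j x ∧ j x ≤ M) :
    Integrable (fun x => u x ^ 2 * j x) μ :=
  hu.integrable_sq.mul_bdd (c := M) hj (by
    filter_upwards [hjM] with x hx
    rw [Real.norm_of_nonneg hx.1]; exact hx.2)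

/-- Multiply `f s * s ≤ A * s ^ 2 + C` by the cutoff and by the weight `j`, both nonnegative. The
term with `A` stays cut off, since `A` may have either sign and is treated only in the limit. -/
theorem integral_mul_logTrunc_le [IsFiniteMeasure μ] {u j : Plane → ℝ} {M : ℝ} (hu : MemLp u 2 μ)
    (hj : AEStronglyMeasurable j μ) (hjM : ∀ᵐ x ∂μ, 0 ≤ j x ∧ j x ≤ M) {f : ℝ → ℝ}
    (hf : Continuous f) {A C : ℝ} (hC : 0 ≤ C) (hfA : ∀ s, f s * s ≤ A * s ^ 2 + C) (n : ℕ) :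
    ∫ x, f (u x) * logTrunc n (u x) * j x ∂μ
      ≤ A * (∫ x, logCutoff n (u x) * (u x ^ 2 * j x) ∂μ) + C * M * μ.real Set.univ := by
  obtain ⟨D, hD⟩ := exists_bound_mul_logTrunc hf n
  have hm : AEStronglyMeasurable (fun x => f (u x) * logTrunc n (u x)) μ :=
    (hf.mul (contDiff_logTrunc n).continuous).comp_aestronglyMeasurable hu.1
  have i1 : Integrable (fun x => f (u x) * logTrunc n (u x) * j x) μ := by
    refine Integrable.of_bound (hm.mul hj) (D * M) ?_
    filter_upwards [hjM] with x hx
    rw [norm_mul, Real.norm_of_nonneg hx.1]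
    exact mul_le_mul (hD _) hx.2 hx.1 ((norm_nonneg _).trans (hD (u x)))
  have i2 := (integrable_logCutoff_mul hu.1 (integrable_sq_mul hu hj hjM) n).const_mul A
  calc ∫ x, f (u x) * logTrunc n (u x) * j x ∂μ
      ≤ ∫ x, (A * (logCutoff n (u x) * (u x ^ 2 * j x)) + C * M) ∂μ := by
        refine integral_mono_ae i1 (i2.add (integrable_const _)) ?_
        filter_upwards [hjM] with x hx
        have h0 := logCutoff_nonneg n (u x)
        have h1 := logCutoff_le_one n (u x)
        have h2 := mul_le_mul_of_nonneg_right (hfA (u x)) (mul_nonneg h0 hx.1)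
        have h3 : logCutoff n (u x) * j x ≤ M :=
          (mul_le_of_le_one_left hx.1 h1).trans hx.2
        have h4 := mul_le_mul_of_nonneg_left h3 hC
        simp only [logTrunc]
        nlinarith
    _ = _ := by
        rw [integral_add i2 (integrable_const _), integral_const_mul]
        simp [mul_comm]

/-- The energy estimate for weak solutions, obtained by testing with truncations. -/
theorem energy_le {σ : Measure Plane} [IsFiniteMeasure μ] [IsFiniteMeasure σ]
    {u w e j k : Plane → ℝ} {f g : ℝ → ℝ} {a A B C D M : ℝ} (hu : MemLp u 2 μ) (hw : MemLp w 2 σ)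
    (he : Integrable e μ) (he0 : ∀ᵐ x ∂μ, 0 ≤ e x)
    (hj : AEStronglyMeasurable j μ) (hjM : ∀ᵐ x ∂μ, 0 ≤ j x ∧ j x ≤ M)
    (hk : AEStronglyMeasurable k σ) (hkM : ∀ᵐ x ∂σ, 0 ≤ k x ∧ k x ≤ M)
    (hf : Continuous f) (hg : Continuous g) (hC : 0 ≤ C) (hD : 0 ≤ D)
    (hfA : ∀ s, f s * s ≤ A * s ^ 2 + C) (hgB : ∀ s, g s * s ≤ B * s ^ 2 + D)
    (heq : ∀ n, (∫ x, deriv (logTrunc n) (u x) * e x ∂μ) + a * (∫ x, u x * logTrunc n (u x) * j x ∂μ)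
      = (∫ x, f (u x) * logTrunc n (u x) * j x ∂μ) + ∫ x, g (w x) * logTrunc n (w x) * k x ∂σ) :
    (∫ x, e x ∂μ) + (a - A) * (∫ x, u x ^ 2 * j x ∂μ) - B * (∫ x, w x ^ 2 * k x ∂σ)
      ≤ C * M * μ.real Set.univ + D * M * σ.real Set.univ := by
  obtain ⟨K, hK0, hK1, hK⟩ := exists_bound_deriv_logTrunc
  have t1 := tendsto_integral_logCutoff hu.1 he
  have t2 := tendsto_integral_logCutoff hu.1 (integrable_sq_mul hu hj hjM)
  have t3 := tendsto_integral_logCutoff hw.1 (integrable_sq_mul hw hk hkM)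
  have t4 : Tendsto (fun n : ℕ => K / ((n : ℝ) + 1) * ∫ x, e x ∂μ) atTop (𝓝 0) := by
    have := (tendsto_one_div_add_atTop_nhds_zero_nat (𝕜 := ℝ)).const_mul K
    simpa [div_eq_mul_inv] using this.mul_const (∫ x, e x ∂μ)
  have t := ((t1.sub t4).add (t2.const_mul (a - A))).sub (t3.const_mul B)
  rw [sub_zero] at t
  -- The cut-off form minus the gradient error is bounded for each `n`, and it converges to the full
  -- form by dominated convergence.
  refine le_of_tendsto' t fun n => ?_
  have b1 : (∫ x, logCutoff n (u x) * e x ∂μ) - K / (n + 1) * ∫ x, e x ∂μ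
      ≤ ∫ x, deriv (logTrunc n) (u x) * e x ∂μ := by
    rw [← integral_const_mul, ← integral_sub (integrable_logCutoff_mul hu.1 he n) (he.const_mul _)]
    refine integral_mono_ae ((integrable_logCutoff_mul hu.1 he n).sub (he.const_mul _)) ?_ ?_
    · exact he.bdd_mul (c := 1 + K) (((contDiff_logTrunc n).continuous_deriv
        (by simp)).comp_aestronglyMeasurable hu.1) (Eventually.of_forall fun x => hK1 n _)
    · filter_upwards [he0] with x hx
      rw [← sub_mul]
      exact mul_le_mul_of_nonneg_right (hK n _) hx
  have b2 := integral_mul_logTrunc_le hu hj hjM hf hC hfA n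
  have b3 := integral_mul_logTrunc_le hw hk hkM hg hD hgB n
  have b4 : ∫ x, u x * logTrunc n (u x) * j x ∂μ = ∫ x, logCutoff n (u x) * (u x ^ 2 * j x) ∂μ :=
    integral_congr_ae (Eventually.of_forall fun x => by simp only [logTrunc]; ring)
  have := heq n
  rw [b4] at this
  linarith

end Energy

/-- Outside a compact set the quotient is below `A`; on it, continuity bounds the difference. -/
theorem exists_mul_self_le {f : ℝ → ℝ} (hf : Continuous f) {c A : ℝ} (h : LimsupQuotientLE f c)
    (hcA : c < A) : ∃ C, 0 ≤ C ∧ ∀ s, f s * s ≤ A * s ^ 2 + C := by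
  have h1 : ∀ᶠ s in cocompact ℝ, ((f s / s : ℝ) : EReal) < (A : EReal) :=
    eventually_lt_of_limsup_lt (h.trans_lt (EReal.coe_lt_coe_iff.2 hcA))
  obtain ⟨K, hK, hKs⟩ := mem_cocompact.1 h1
  obtain ⟨C, hC⟩ := hK.exists_bound_of_continuousOn (f := fun s => f s * s - A * s ^ 2)
    (Continuous.continuousOn (by fun_prop))
  refine ⟨max C 0, le_max_right _ _, fun s => ?_⟩
  by_cases hs : s ∈ K
  · linarith [(le_abs_self _).trans (hC s hs), le_max_left C 0]
  · have h2 : f s / s < A := EReal.coe_lt_coe_iff.1 (hKs hs)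
    -- The compact set need not contain `0`.
    rcases eq_or_ne s 0 with rfl | h0
    · simp
    · have h3 : f s * s = f s / s * s ^ 2 := by field_simp
      nlinarith [le_max_right C 0, sq_nonneg s]

/-! ### Smallness of the perturbation -/

/-- The size condition on `ε` under which all coefficients are within `η` of the unperturbed
ones. -/
structure IsSmall (α ε η : ℝ) : Prop where
  eps_pos : 0 < ε
  eps_le : ε ≤ η
  rpow_le : ε ^ (1 - α) ≤ η
  eta_le : η ≤ 1 / 10

/-- The hypothesis `α < 1` makes `ε ^ (1 - α)`, the size of the slope of `h_ε`, tend to `0`. -/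
theorem exists_isSmall {α η : ℝ} (hα : α < 1) (hη : 0 < η) (hη' : η ≤ 1 / 10) :
    ∃ ε₀ > 0, ∀ ε, 0 < ε → ε < ε₀ → IsSmall α ε η := by
  have h1 : 0 < 1 - α := by linarith
  refine ⟨min η (η ^ (1 / (1 - α))), by positivity, fun ε h0 hlt =>
    ⟨h0, (hlt.trans_le (min_le_left _ _)).le, ?_, hη'⟩⟩
  have h2 : ε ≤ η ^ (1 / (1 - α)) := (hlt.trans_le (min_le_right _ _)).le
  calc ε ^ (1 - α) ≤ (η ^ (1 / (1 - α))) ^ (1 - α) := Real.rpow_le_rpow h0.le h2 h1.le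
    _ = η := by rw [← Real.rpow_mul hη.le, one_div_mul_cancel h1.ne', Real.rpow_one]

namespace IsSmall

variable {α ε η : ℝ}

theorem eta_pos (h : IsSmall α ε η) : 0 < η := h.eps_pos.trans_le h.eps_le

theorem abs_jac_sub_one_le (h : IsSmall α ε η) (x : Plane) : |jac α ε x - 1| ≤ η := by
  rw [jac, add_sub_cancel_left, abs_mul, abs_of_pos h.eps_pos]
  exact (mul_le_of_le_one_right h.eps_pos.le (Real.abs_sin_le_one _)).trans h.eps_le

theorem jac_bounds (h : IsSmall α ε η) (x : Plane) : 9 / 10 ≤ jac α ε x ∧ jac α ε x ≤ 11 / 10 := by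
  have := abs_le.1 (h.abs_jac_sub_one_le x)
  constructor <;> linarith [h.eta_le]

theorem jac_pos (h : IsSmall α ε η) (x : Plane) : 0 < jac α ε x := by
  linarith [(h.jac_bounds x).1]

theorem abs_slope_le (h : IsSmall α ε η) {t : ℝ} (ht : |t| ≤ 1) (s : ℝ) :
    |t * ε ^ (1 - α) * Real.cos s| ≤ η := by
  rw [abs_mul, abs_mul, abs_of_pos (Real.rpow_pos_of_pos h.eps_pos _)]
  have h1 := Real.abs_cos_le_one s
  have h2 := Real.rpow_pos_of_pos h.eps_pos (1 - α)
  calc |t| * ε ^ (1 - α) * |Real.cos s| ≤ 1 * ε ^ (1 - α) * 1 := by gcongr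
    _ ≤ η := by linarith [h.rpow_le]

theorem abs_b12_le (h : IsSmall α ε η) {x : Plane} (hx : x ∈ square) : |b12 α ε x| ≤ 2 * η := by
  have h1 : |x 1| ≤ 1 := abs_le.2 ⟨by linarith [hx.2.2.1], hx.2.2.2.le⟩
  rw [b12, abs_div, abs_neg, abs_of_pos (h.jac_pos x), div_le_iff₀ (h.jac_pos x)]
  nlinarith [h.abs_slope_le h1 (x 0 / ε ^ α), (h.jac_bounds x).1, h.eta_pos]

theorem abs_sqrt_sub_one_le (h : IsSmall α ε η) {q : ℝ} (hq : |q| ≤ η) :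
    |Real.sqrt (1 + q ^ 2) - 1| ≤ η := by
  have h1 : 1 ≤ Real.sqrt (1 + q ^ 2) := Real.one_le_sqrt.2 (by nlinarith [sq_nonneg q])
  have h2 : Real.sqrt (1 + q ^ 2) ≤ 1 + η :=
    Real.sqrt_le_iff.2 ⟨by linarith [h.eta_pos], by
      nlinarith [sq_abs q, abs_nonneg q, h.eta_pos]⟩
  rw [abs_of_nonneg (by linarith)]
  linarith

theorem abs_bdryJac_sub_one_le (h : IsSmall α ε η) (x : Plane) : |bdryJac α ε x - 1| ≤ η := by
  unfold bdryJac
  split_ifs with hx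
  · refine h.abs_sqrt_sub_one_le (h.abs_slope_le ?_ _)
    rcases hx with hx | hx <;> simp [hx]
  · rw [abs_of_pos (h.jac_pos x)]
    exact h.abs_jac_sub_one_le x

end IsSmall

theorem contDiff_jac (α ε : ℝ) : ContDiff ℝ ∞ (jac α ε) :=
  contDiff_const.add (contDiff_const.mul (((contDiff_coord 0).div_const _).sin))

theorem measurable_bdryJac (α ε : ℝ) : Measurable (bdryJac α ε) := by
  have m1 : Measurable fun x : Plane => x 1 := (contDiff_coord (n := 0) 1).continuous.measurable
  have m0 : Measurable fun x : Plane => x 0 := (contDiff_coord (n := 0) 0).continuous.measurable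
  have mj : Measurable (jac α ε) := (contDiff_jac α ε).continuous.measurable
  refine Measurable.ite ?_ ?_ mj.abs
  · exact (measurableSet_eq_fun m1 measurable_const).union
      (measurableSet_eq_fun m1 measurable_const)
  · fun_prop

/-- The transformed gradient density is close to the original one. -/
theorem abs_transformed_sub_le {η J b g₀ g₁ : ℝ} (hη : 0 < η) (hη' : η ≤ 1 / 10)
    (hJ : |J - 1| ≤ η) (hb : |b| ≤ 2 * η) :
    |((g₀ + b * g₁) ^ 2 + (1 / J * g₁) ^ 2) * J - (g₀ ^ 2 + g₁ ^ 2)|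
      ≤ 10 * η * (g₀ ^ 2 + g₁ ^ 2) := by
  obtain ⟨j1, j2⟩ := abs_le.1 hJ
  have J0 : 9 / 10 ≤ J := by linarith
  have J1 : J ≤ 11 / 10 := by linarith
  have hi : |1 / J - 1| ≤ 2 * η := by
    have e : 1 / J - 1 = -(J - 1) / J := by field_simp; ring
    rw [e, abs_div, abs_neg, abs_of_pos (by linarith : 0 < J), div_le_iff₀ (by linarith)]
    nlinarith
  -- The four terms contribute at most `η`, `2.2η`, `0.44η` and `2η` times squares of the gradient,
  -- well below `10η`.
  have e : ((g₀ + b * g₁) ^ 2 + (1 / J * g₁) ^ 2) * J - (g₀ ^ 2 + g₁ ^ 2)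
      = (J - 1) * g₀ ^ 2 + J * b * (2 * g₀ * g₁) + J * b ^ 2 * g₁ ^ 2
        + (1 / J - 1) * g₁ ^ 2 := by
    field_simp; ring
  have hJb : |J * b| ≤ 11 / 10 * (2 * η) := by
    rw [abs_mul, abs_of_pos (by linarith : 0 < J)]
    exact mul_le_mul J1 hb (abs_nonneg _) (by norm_num)
  have hJb2 : J * b ^ 2 ≤ 11 / 10 * (4 / 10 * η) := by
    have : b ^ 2 ≤ 4 / 10 * η := by
      rw [← sq_abs]; nlinarith [abs_nonneg b]
    exact mul_le_mul J1 this (sq_nonneg _) (by norm_num)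
  have h2 : |2 * g₀ * g₁| ≤ g₀ ^ 2 + g₁ ^ 2 :=
    abs_le.2 ⟨by nlinarith [sq_nonneg (g₀ + g₁)], by nlinarith [sq_nonneg (g₀ - g₁)]⟩
  rw [e]
  have t1 : |(J - 1) * g₀ ^ 2| ≤ η * g₀ ^ 2 := by
    rw [abs_mul, abs_of_nonneg (sq_nonneg g₀)]
    exact mul_le_mul_of_nonneg_right hJ (sq_nonneg _)
  have t2 : |J * b * (2 * g₀ * g₁)| ≤ 11 / 10 * (2 * η) * (g₀ ^ 2 + g₁ ^ 2) := by
    rw [abs_mul]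
    exact mul_le_mul hJb h2 (abs_nonneg _) (by positivity)
  have t3 : |J * b ^ 2 * g₁ ^ 2| ≤ 11 / 10 * (4 / 10 * η) * g₁ ^ 2 := by
    rw [abs_of_nonneg (mul_nonneg (mul_nonneg (by linarith) (sq_nonneg _)) (sq_nonneg _))]
    exact mul_le_mul_of_nonneg_right hJb2 (sq_nonneg _)
  have t4 : |(1 / J - 1) * g₁ ^ 2| ≤ 2 * η * g₁ ^ 2 := by
    rw [abs_mul, abs_of_nonneg (sq_nonneg g₁)]
    exact mul_le_mul_of_nonneg_right hi (sq_nonneg _)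
  have s1 := abs_add_le ((J - 1) * g₀ ^ 2 + J * b * (2 * g₀ * g₁) + J * b ^ 2 * g₁ ^ 2)
    ((1 / J - 1) * g₁ ^ 2)
  have s2 := abs_add_le ((J - 1) * g₀ ^ 2 + J * b * (2 * g₀ * g₁)) (J * b ^ 2 * g₁ ^ 2)
  have s3 := abs_add_le ((J - 1) * g₀ ^ 2) (J * b * (2 * g₀ * g₁))
  nlinarith [mul_nonneg hη.le (sq_nonneg g₀), mul_nonneg hη.le (sq_nonneg g₁)]

/-- Of the `c * (E + N + S)` at hand, the perturbation costs `c/4` of each of `E`, `N`, `S`, and the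
shift `δ` another `c/4` of `N`, so `c/2` of `E + N` remains. The first conclusion serves the norm on
the square, the second, through `E' + N' ≤ 2(E + N)`, the norm on the perturbed domain. -/
theorem coercive_of_close {c b d δ D η E N S E' N' S' : ℝ} (hE : 0 ≤ E) (hN : 0 ≤ N) (hS : 0 ≤ S)
    (hc : 0 ≤ c) (h : c * (E + N + S) ≤ E + b * N - d * S) (hD : D ≤ d) (hδ : δ ≤ c / 4)
    (hη : 0 ≤ η) (hη' : η ≤ 1 / 10) (hηc : (10 + |b - δ| + |D|) * η ≤ c / 4)
    (hE' : |E' - E| ≤ 10 * η * E) (hN' : |N' - N| ≤ η * N) (hS' : |S' - S| ≤ η * S) :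
    c / 2 * (E + N) ≤ E' + (b - δ) * N' - D * S' ∧
      c / 4 * (E' + N') ≤ E' + (b - δ) * N' - D * S' := by
  obtain ⟨e1, e2⟩ := abs_le.1 hE'
  obtain ⟨n1, n2⟩ := abs_le.1 hN'
  have a1 : (b - δ) * N - |b - δ| * (η * N) ≤ (b - δ) * N' := by
    have h1 := neg_abs_le ((b - δ) * (N' - N))
    rw [abs_mul] at h1
    nlinarith [mul_le_mul_of_nonneg_left hN' (abs_nonneg (b - δ))]
  have a2 : D * S' ≤ D * S + |D| * (η * S) := by
    have h1 := le_abs_self (D * (S' - S))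
    rw [abs_mul] at h1
    nlinarith [mul_le_mul_of_nonneg_left hS' (abs_nonneg D)]
  have a3 : D * S ≤ d * S := mul_le_mul_of_nonneg_right hD hS
  have hb := abs_nonneg (b - δ)
  have hDn := abs_nonneg D
  have k1 : 10 * η ≤ c / 4 := by nlinarith [mul_nonneg hb hη, mul_nonneg hDn hη]
  have k2 : |b - δ| * η ≤ c / 4 := by nlinarith [mul_nonneg hDn hη]
  have k3 : |D| * η ≤ c / 4 := by nlinarith [mul_nonneg hb hη]
  have m1 := mul_le_mul_of_nonneg_right k1 hE
  have m2 := mul_le_mul_of_nonneg_right k2 hN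
  have m3 := mul_le_mul_of_nonneg_right k3 hS
  have m4 := mul_le_mul_of_nonneg_right hδ hN
  have key : c / 2 * (E + N) ≤ E' + (b - δ) * N' - D * S' := by
    nlinarith [mul_nonneg hc hE, mul_nonneg hc hS]
  refine ⟨key, le_trans ?_ key⟩
  have : E' + N' ≤ 2 * (E + N) := by nlinarith
  nlinarith

theorem abs_integral_sub_le {X : Type*} [MeasurableSpace X] {μ : Measure X} {F F' : X → ℝ} {η : ℝ}
    (hF : Integrable F μ) (hF' : Integrable F' μ) (h : ∀ᵐ x ∂μ, |F' x - F x| ≤ η * F x) :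
    |(∫ x, F' x ∂μ) - ∫ x, F x ∂μ| ≤ η * ∫ x, F x ∂μ := by
  rw [← integral_sub hF' hF, ← integral_const_mul]
  exact norm_integral_le_of_norm_le (f := fun x => F' x - F x) (hF.const_mul η) h

theorem abs_mul_sub_le {F j η : ℝ} (hF : 0 ≤ F) (hj : |j - 1| ≤ η) : |F * j - F| ≤ η * F := by
  have : F * j - F = (j - 1) * F := by ring
  rw [this, abs_mul, abs_of_nonneg hF]
  exact mul_le_mul_of_nonneg_right hj hF

/-! ### Equilibria of the pulled-back problem -/

theorem norm_pullGrad_sq (α ε : ℝ) (u : Plane → ℝ) (x : Plane) :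
    ‖pullGrad α ε u x‖ ^ 2 = (weakGrad square u x 0 + b12 α ε x * weakGrad square u x 1) ^ 2
      + (1 / jac α ε x * weakGrad square u x 1) ^ 2 := by
  rw [norm_sq_plane]; simp [pullGrad]

theorem IsSmall.abs_pullGrad_sub_le {α ε η : ℝ} (h : IsSmall α ε η) (u : Plane → ℝ) {x : Plane}
    (hx : x ∈ square) :
    |‖pullGrad α ε u x‖ ^ 2 * jac α ε x - ‖weakGrad square u x‖ ^ 2|
      ≤ 10 * η * ‖weakGrad square u x‖ ^ 2 := by
  rw [norm_pullGrad_sq, norm_sq_plane]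
  exact abs_transformed_sub_le h.eta_pos h.eta_le (h.abs_jac_sub_one_le x) (h.abs_b12_le hx)

theorem IsSmall.continuous_b12 {α ε η : ℝ} (h : IsSmall α ε η) : Continuous (b12 α ε) := by
  have c0 : Continuous fun x : Plane => x 0 := (contDiff_coord (n := 0) 0).continuous
  have c1 : Continuous fun x : Plane => x 1 := (contDiff_coord (n := 0) 1).continuous
  refine Continuous.div ?_ (contDiff_jac α ε).continuous fun x => (h.jac_pos x).ne'
  fun_prop

theorem IsSmall.integrable_pullGrad {α ε η : ℝ} (h : IsSmall α ε η) {u : Plane → ℝ}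
    (hu : MemLp (weakGrad square u) 2 (volume.restrict square)) :
    Integrable (fun x => ‖pullGrad α ε u x‖ ^ 2 * jac α ε x) (volume.restrict square) := by
  have hi : Integrable (fun x => ‖weakGrad square u x‖ ^ 2) (volume.restrict square) :=
    hu.integrable_norm_pow (by norm_num)
  have mG : ∀ i : Fin 2, AEStronglyMeasurable (fun x => weakGrad square u x i)
      (volume.restrict square) := fun i =>
    (contDiff_coord (n := 0) i).continuous.comp_aestronglyMeasurable hu.1
  have cj := (contDiff_jac α ε).continuous
  have cb := h.continuous_b12
  have ci : Continuous fun x => 1 / jac α ε x :=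
    continuous_const.div cj fun x => (h.jac_pos x).ne'
  refine (hi.const_mul 2).mono' ?_ ?_
  · simp_rw [norm_pullGrad_sq]
    exact ((((mG 0).add (cb.aestronglyMeasurable.mul (mG 1))).pow 2).add
      ((ci.aestronglyMeasurable.mul (mG 1)).pow 2)).mul cj.aestronglyMeasurable
  · refine (ae_restrict_iff' isOpen_square.measurableSet).2 (Eventually.of_forall fun x hx => ?_)
    rw [Real.norm_of_nonneg (mul_nonneg (sq_nonneg _) (h.jac_pos x).le)]
    have h1 := (abs_le.1 (h.abs_pullGrad_sub_le u hx)).2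
    have h2 : 10 * η * ‖weakGrad square u x‖ ^ 2 ≤ 1 * ‖weakGrad square u x‖ ^ 2 :=
      mul_le_mul_of_nonneg_right (by linarith [h.eta_le]) (sq_nonneg _)
    linarith

/-- The weak formulation tested with `θ(u) J`. -/
theorem equilibria_test {α ε η a : ℝ} (h : IsSmall α ε η) {f g : ℝ → ℝ} {u w : Plane → ℝ}
    (hu : H1Approx square squareBdry u (weakGrad square u) w)
    (heq : ∀ ψ χ, MemH1 square ψ → IsTrace square squareBdry ψ χ →
      opA α ε a u ψ = opF f u ψ + opG α ε g w χ)
    {θ : ℝ → ℝ} {C : ℝ} (hθ : ContDiff ℝ ∞ θ) (hC : ∀ s, |deriv θ s| ≤ C) :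
    (∫ x in square, deriv θ (u x) * (‖pullGrad α ε u x‖ ^ 2 * jac α ε x))
        + a * (∫ x in square, u x * θ (u x) * jac α ε x)
      = (∫ x in square, f (u x) * θ (u x) * jac α ε x)
        + ∫ x, g (w x) * θ (w x) * bdryJac α ε x ∂squareBdry := by
  have hc := hu.comp isBounded_square compactlyCarried_squareBdry hθ hC
  -- The factor `jac` in the test function cancels the division by `|Jh_ε|` inside `A_ε` and in the
  -- boundary density, which restores a symmetric gradient term.
  have hm := hc.mul isBounded_square compactlyCarried_squareBdry (contDiff_jac α ε)
  have key := heq _ _ (hm.memH1 isBounded_square) (hm.isTrace isOpen_square isBounded_square)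
  have e0 : (fun y => (θ ∘ u) y * jac α ε y / |jac α ε y|) = θ ∘ u := by
    ext y
    rw [abs_of_pos (h.jac_pos y), mul_div_cancel_right₀ _ (h.jac_pos y).ne']
  have e1 : ∫ x in square, inner ℝ (pullGrad α ε u x) (pullGrad α ε (θ ∘ u) x) * |jac α ε x|
      = ∫ x in square, deriv θ (u x) * (‖pullGrad α ε u x‖ ^ 2 * jac α ε x) := by
    refine integral_congr_ae ?_
    filter_upwards [hc.weakGrad_ae_eq isOpen_square isBounded_square] with x hx
    have : pullGrad α ε (θ ∘ u) x = deriv θ (u x) • pullGrad α ε u x := by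
      ext i
      fin_cases i
      · simp [pullGrad, hx]; ring
      · simp [pullGrad, hx]; ring
    rw [this, real_inner_smul_right, real_inner_self_eq_norm_sq, abs_of_pos (h.jac_pos x)]
    ring
  have e2 : ∀ x, |bdryJac α ε x / jac α ε x| = bdryJac α ε x / jac α ε x := fun x =>
    abs_of_nonneg (div_nonneg (by
      linarith [(abs_le.1 (h.abs_bdryJac_sub_one_le x)).1, h.eta_le]) (h.jac_pos x).le)
  have e3 : ∀ x, g (w x) * ((θ ∘ w) x * jac α ε x) * (bdryJac α ε x / jac α ε x)
      = g (w x) * θ (w x) * bdryJac α ε x := fun x => by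
    have := (h.jac_pos x).ne'
    simp only [Function.comp]
    field_simp
  simp only [opA, opF, opG] at key
  rw [e0, e1] at key
  simp only [e2, e3] at key
  simpa only [Function.comp, mul_assoc] using key

/-- The energy estimate with weights `jac` and `bdryJac`, both at most `2`, bounds the perturbed
form from above; closeness to the Robin form bounds it from below. -/
theorem IsSmall.equilibria_bound {α ε η a : ℝ} (h : IsSmall α ε η) {f g : ℝ → ℝ}
    (hf : Continuous f) (hg : Continuous g) {A B C D c c₀ d₀ δ : ℝ}
    (hC : 0 ≤ C) (hD : 0 ≤ D)
    (hfA : ∀ s, f s * s ≤ A * s ^ 2 + C) (hgB : ∀ s, g s * s ≤ B * s ^ 2 + D) (hc : 0 < c)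
    (hco : ∀ u G w, H1Approx square squareBdry u G w →
      c * ((∫ x in square, ‖G x‖ ^ 2) + (∫ x in square, u x ^ 2) + ∫ x, w x ^ 2 ∂squareBdry)
        ≤ (∫ x in square, ‖G x‖ ^ 2) + (a - c₀) * (∫ x in square, u x ^ 2)
          - d₀ * ∫ x, w x ^ 2 ∂squareBdry)
    (hA : A = c₀ + δ) (hB : B ≤ d₀) (hδ : δ ≤ c / 4)
    (hη : (10 + |a - c₀ - δ| + |B|) * η ≤ c / 4) {u : Plane → ℝ}
    (hu : u ∈ equilibria α ε a f g) :
    c / 2 * h1Norm square u ^ 2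
      ≤ C * 2 * (volume.restrict square).real Set.univ + D * 2 * squareBdry.real Set.univ := by
  obtain ⟨hu1, w, hw, heq⟩ := hu
  have hap := hw.h1Approx isOpen_square isBounded_square
  have fin1 := (compactlyCarried_restrict isBounded_square).finite
  have fin2 := compactlyCarried_squareBdry.finite
  obtain ⟨K, hK0, hK, -⟩ := exists_bound_deriv_logTrunc
  have hj : AEStronglyMeasurable (jac α ε) (volume.restrict square) :=
    (contDiff_jac α ε).continuous.aestronglyMeasurable
  have hk : AEStronglyMeasurable (bdryJac α ε) squareBdry :=
    (measurable_bdryJac α ε).aestronglyMeasurable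
  have hjM : ∀ᵐ x ∂(volume.restrict square), 0 ≤ jac α ε x ∧ jac α ε x ≤ 2 :=
    Eventually.of_forall fun x => by constructor <;> linarith [h.jac_bounds x]
  have hkM : ∀ᵐ x ∂squareBdry, 0 ≤ bdryJac α ε x ∧ bdryJac α ε x ≤ 2 :=
    Eventually.of_forall fun x => by
      have := abs_le.1 (h.abs_bdryJac_sub_one_le x)
      constructor <;> linarith [h.eta_le]
  have he := h.integrable_pullGrad hap.memLp_grad
  have energy := energy_le (a := a) hap.memLp hap.memLp_trace he
    (Eventually.of_forall fun x => mul_nonneg (sq_nonneg _) (h.jac_pos x).le) hj hjM hk hkM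
    hf hg hC hD hfA hgB
    (fun n => equilibria_test h hap heq (contDiff_logTrunc n) (hK n))
  have close := (coercive_of_close (b := a - c₀) (by positivity) (by positivity) (by positivity)
    hc.le (hco _ _ _ hap) hB hδ h.eta_pos.le h.eta_le hη
    (abs_integral_sub_le (hap.memLp_grad.integrable_norm_pow (by norm_num)) he
      ((ae_restrict_iff' isOpen_square.measurableSet).2
        (Eventually.of_forall fun x hx => h.abs_pullGrad_sub_le u hx)))
    (abs_integral_sub_le hap.memLp.integrable_sq (integrable_sq_mul hap.memLp hj hjM)
      (Eventually.of_forall fun x => abs_mul_sub_le (sq_nonneg _) (h.abs_jac_sub_one_le x)))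
    (abs_integral_sub_le hap.memLp_trace.integrable_sq (integrable_sq_mul hap.memLp_trace hk hkM)
      (Eventually.of_forall fun x =>
        abs_mul_sub_le (sq_nonneg _) (h.abs_bdryJac_sub_one_le x)))).1
  rw [hA, ← sub_sub] at energy
  rw [h1Norm, Real.sq_sqrt (by positivity), add_comm (∫ x in square, u x ^ 2)]
  exact close.trans energy

/-! ### The map `h_ε` and the perturbed domain -/

/-- The linear map with matrix `!![1, 0; q, J]`. -/
def shear (q J : ℝ) : Plane →L[ℝ] Plane :=
  LinearMap.toContinuousLinearMap
    (Matrix.toLin (EuclideanSpace.basisFun (Fin 2) ℝ).toBasis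
      (EuclideanSpace.basisFun (Fin 2) ℝ).toBasis !![1, 0; q, J])

theorem det_shear (q J : ℝ) : (shear q J).det = J := by
  rw [ContinuousLinearMap.det, shear, LinearMap.coe_toContinuousLinearMap, LinearMap.det_toLin]
  simp

theorem shear_apply (q J : ℝ) (v : Plane) : shear q J v = !₂[v 0, q * v 0 + J * v 1] := by
  ext i
  fin_cases i <;>
  simp [shear, Matrix.toLin_apply, Matrix.mulVec, dotProduct]

theorem contDiff_hMap (α ε : ℝ) : ContDiff ℝ ∞ (hMap α ε) := by
  have c0 := contDiff_coord (n := ∞) 0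
  have c1 := contDiff_coord (n := ∞) 1
  rw [contDiff_euclidean]
  intro i
  fin_cases i
  · exact c0
  · exact c1.add ((c1.mul contDiff_const).mul ((c0.div_const _).sin))

/-- The entry `∂₁ (h_ε)₂` of the Jacobian matrix. -/
def slope (α ε : ℝ) (x : Plane) : ℝ := x 1 * ε ^ (1 - α) * Real.cos (x 0 / ε ^ α)

theorem hasFDerivAt_hMap {α ε : ℝ} (hε : 0 < ε) (x : Plane) :
    HasFDerivAt (hMap α ε) (shear (slope α ε x) (jac α ε x)) x := by
  have p : ∀ i : Fin 2, HasFDerivAt (fun y : Plane => y i)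
      (EuclideanSpace.proj i : Plane →L[ℝ] ℝ) x := fun i =>
    (EuclideanSpace.proj i : Plane →L[ℝ] ℝ).hasFDerivAt
  rw [← hasFDerivWithinAt_univ, hasFDerivWithinAt_euclidean]
  intro i
  rw [hasFDerivWithinAt_univ]
  fin_cases i
  · refine (p 0).congr_fderiv ?_
    ext v
    simp [shear_apply]
  · have hs := ((p 0).mul_const (ε ^ α)⁻¹).sin
    refine ((p 1).add (((p 1).mul_const ε).mul hs)).congr_fderiv ?_
    -- The derivative of `ε sin(x₁/ε^α)` has size `ε · ε^(-α)`.
    have e : ε ^ (1 - α) = ε * (ε ^ α)⁻¹ := by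
      rw [Real.rpow_sub hε, Real.rpow_one, div_eq_mul_inv]
    ext v
    simp [shear_apply, slope, jac, e, div_eq_mul_inv]
    ring

theorem gradient_comp_hMap {α ε : ℝ} (hε : 0 < ε) {φ : Plane → ℝ} (hφ : ContDiff ℝ ∞ φ)
    (x : Plane) :
    gradient (φ ∘ hMap α ε) x 0
        = gradient φ (hMap α ε x) 0 + slope α ε x * gradient φ (hMap α ε x) 1 ∧
      gradient (φ ∘ hMap α ε) x 1 = jac α ε x * gradient φ (hMap α ε x) 1 := by
  have d := (hφ.differentiable (by simp)).differentiableAt (x := hMap α ε x)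
  have h := d.hasFDerivAt.comp x (hasFDerivAt_hMap (α := α) hε x)
  have e : ∀ v : Plane, inner ℝ (gradient (φ ∘ hMap α ε) x) v
      = inner ℝ (gradient φ (hMap α ε x)) (shear (slope α ε x) (jac α ε x) v) := fun v => by
    rw [inner_gradient, inner_gradient, h.fderiv]; rfl
  constructor
  · have := e !₂[1, 0]
    simp only [shear_apply, inner_plane] at this
    simpa [mul_comm] using this
  · have := e !₂[0, 1]
    simp only [shear_apply, inner_plane] at this
    simpa [mul_comm] using this

namespace IsSmall

variable {α ε η : ℝ}

theorem hMap_eq (x : Plane) : hMap α ε x = !₂[x 0, jac α ε x * x 1] := by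
  ext i
  fin_cases i
  · rfl
  · simp [hMap, jac]; ring

/-- The map keeps the first coordinate, and `jac` depends on that coordinate alone, so on vertical
lines the map is multiplication by a positive constant. -/
theorem injective_hMap (h : IsSmall α ε η) : Function.Injective (hMap α ε) := by
  intro x y hxy
  have h0 : (hMap α ε x) 0 = (hMap α ε y) 0 := by rw [hxy]
  change x 0 = y 0 at h0
  have h1 : jac α ε x * x 1 = jac α ε y * y 1 := by
    rw [hMap_eq, hMap_eq] at hxy
    exact congrArg (fun z : Plane => z 1) hxy
  have hj : jac α ε x = jac α ε y := by rw [jac, jac, h0]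
  rw [hj] at h1
  ext i
  fin_cases i
  · exact h0
  · exact mul_left_cancel₀ (h.jac_pos y).ne' h1

theorem perturbedDomain_eq (h : IsSmall α ε η) :
    perturbedDomain α ε = {y | 0 < y 0 ∧ y 0 < 1 ∧ 0 < y 1 ∧ y 1 < jac α ε y} := by
  ext y
  constructor
  · rintro ⟨x, ⟨h0, h1, h2, h3⟩, rfl⟩
    have hj : jac α ε (hMap α ε x) = jac α ε x := rfl
    have hJ := h.jac_pos x
    change 0 < (hMap α ε x) 0 ∧ _ ∧ _ ∧ _ < jac α ε (hMap α ε x)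
    rw [hj, hMap_eq]
    exact ⟨h0, h1, mul_pos hJ h2, mul_lt_of_lt_one_right hJ h3⟩
  · rintro ⟨h0, h1, h2, h3⟩
    have hJ := h.jac_pos y
    refine ⟨!₂[y 0, y 1 / jac α ε y], ⟨h0, h1, div_pos h2 hJ, (div_lt_one hJ).2 h3⟩, ?_⟩
    have hj : jac α ε !₂[y 0, y 1 / jac α ε y] = jac α ε y := rfl
    rw [hMap_eq, hj]
    ext i
    fin_cases i
    · rfl
    · exact mul_div_cancel₀ _ hJ.ne'

theorem isOpen_perturbedDomain (h : IsSmall α ε η) : IsOpen (perturbedDomain α ε) := by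
  have h0 : Continuous fun x : Plane => x 0 := by fun_prop
  have h1 : Continuous fun x : Plane => x 1 := by fun_prop
  rw [h.perturbedDomain_eq]
  exact (isOpen_lt continuous_const h0).inter ((isOpen_lt h0 continuous_const).inter
    ((isOpen_lt continuous_const h1).inter (isOpen_lt h1 (contDiff_jac α ε).continuous)))

theorem isBounded_perturbedDomain (h : IsSmall α ε η) :
    Bornology.IsBounded (perturbedDomain α ε) := by
  rw [h.perturbedDomain_eq]
  refine isBounded_of_abs_le (C := 2) fun x ⟨h0, h1, h2, h3⟩ => ?_
  constructor <;> rw [abs_le] <;> constructor <;> linarith [(h.jac_bounds x).2]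

theorem integral_perturbedDomain (h : IsSmall α ε η) (F : Plane → ℝ) :
    ∫ y in perturbedDomain α ε, F y = ∫ x in square, F (hMap α ε x) * jac α ε x := by
  rw [perturbedDomain, integral_image_eq_integral_abs_det_fderiv_smul volume
    isOpen_square.measurableSet
    (fun x _ => (hasFDerivAt_hMap h.eps_pos x).hasFDerivWithinAt) h.injective_hMap.injOn]
  simp_rw [det_shear, abs_of_pos (h.jac_pos _), smul_eq_mul, mul_comm]

/-- Solving the chain rule for `∇φ` brings out the coefficients `b12` and `1 / jac`, so the estimate
for the pulled-back gradient applies again. -/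
theorem abs_norm_gradient_sub_le (h : IsSmall α ε η) {φ : Plane → ℝ} (hφ : ContDiff ℝ ∞ φ)
    {x : Plane} (hx : x ∈ square) :
    |‖gradient φ (hMap α ε x)‖ ^ 2 * jac α ε x - ‖gradient (φ ∘ hMap α ε) x‖ ^ 2|
      ≤ 10 * η * ‖gradient (φ ∘ hMap α ε) x‖ ^ 2 := by
  obtain ⟨g0, g1⟩ := gradient_comp_hMap (α := α) h.eps_pos hφ x
  have hJ := (h.jac_pos x).ne'
  have := abs_transformed_sub_le (g₀ := gradient (φ ∘ hMap α ε) x 0)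
    (g₁ := gradient (φ ∘ hMap α ε) x 1) h.eta_pos h.eta_le (h.abs_jac_sub_one_le x)
    (h.abs_b12_le hx)
  have e0 : gradient φ (hMap α ε x) 0
      = gradient (φ ∘ hMap α ε) x 0 + b12 α ε x * gradient (φ ∘ hMap α ε) x 1 := by
    rw [g0, g1, b12, slope]; field_simp; ring
  have e1 : gradient φ (hMap α ε x) 1 = 1 / jac α ε x * gradient (φ ∘ hMap α ε) x 1 := by
    rw [g1]; field_simp
  rw [norm_sq_plane, norm_sq_plane, e0, e1]
  exact this

theorem contDiff_hMap_side (i : Fin 4) : ContDiff ℝ 1 (hMap α ε ∘ side i) :=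
  ((contDiff_hMap α ε).comp (contDiff_side i)).of_le (by simp)

theorem compactlyCarried_perturbedBdry : CompactlyCarried (perturbedBdry α ε) :=
  CompactlyCarried.sum fun i => compactlyCarried_arcMeasure (contDiff_hMap_side i)

/-- The image curve has speed `√(1 + slope²)` on horizontal sides and `jac` on vertical ones. -/
theorem abs_norm_deriv_sub_one_le (h : IsSmall α ε η) (i : Fin 4) (s : ℝ) :
    |‖deriv (hMap α ε ∘ side i) s‖ - 1| ≤ η := by
  have key : ∀ {c₀ c₁ : ℝ → ℝ} {a b : ℝ}, HasDerivAt c₀ a s → HasDerivAt c₁ b s →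
      ‖deriv (hMap α ε ∘ fun s => !₂[c₀ s, c₁ s]) s‖
        = Real.sqrt (a ^ 2 + (slope α ε !₂[c₀ s, c₁ s] * a + jac α ε !₂[c₀ s, c₁ s] * b) ^ 2) := by
    intro c₀ c₁ a b h0 h1
    have := (hasFDerivAt_hMap (α := α) h.eps_pos !₂[c₀ s, c₁ s]).comp_hasDerivAt s
      (hasDerivAt_mk h0 h1)
    rw [this.deriv, shear_apply, norm_mk]
    simp
  have d := hasDerivAt_id' s
  have c := fun a : ℝ => hasDerivAt_const s a
  fin_cases i
  · change |‖deriv (hMap α ε ∘ fun s => !₂[s, 0]) s‖ - 1| ≤ η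
    rw [key d (c 0), mul_one, mul_zero, add_zero, one_pow]
    exact h.abs_sqrt_sub_one_le (h.abs_slope_le (t := (0 : ℝ)) (by simp) _)
  · change |‖deriv (hMap α ε ∘ fun s => !₂[s, 1]) s‖ - 1| ≤ η
    rw [key d (c 1), mul_one, mul_zero, add_zero, one_pow]
    exact h.abs_sqrt_sub_one_le (h.abs_slope_le (t := (1 : ℝ)) (by simp) _)
  · change |‖deriv (hMap α ε ∘ fun s => !₂[0, s]) s‖ - 1| ≤ η
    rw [key (c 0) d, mul_one, mul_zero, zero_add, zero_pow two_ne_zero, zero_add,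
      Real.sqrt_sq (h.jac_pos _).le]
    exact h.abs_jac_sub_one_le _
  · change |‖deriv (hMap α ε ∘ fun s => !₂[1, s]) s‖ - 1| ≤ η
    rw [key (c 1) d, mul_one, mul_zero, zero_add, zero_pow two_ne_zero, zero_add,
      Real.sqrt_sq (h.jac_pos _).le]
    exact h.abs_jac_sub_one_le _

/-- Both boundary measures are parametrized by the same four intervals, so only the speeds have to
be compared. -/
theorem abs_integral_perturbedBdry_sub_le (h : IsSmall α ε η) {F : Plane → ℝ} (hF : Continuous F)
    (hF0 : ∀ x, 0 ≤ F x) :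
    |(∫ y, F y ∂(perturbedBdry α ε)) - ∫ x, F (hMap α ε x) ∂squareBdry|
      ≤ η * ∫ x, F (hMap α ε x) ∂squareBdry := by
  have hFh : Continuous fun x => F (hMap α ε x) := hF.comp (contDiff_hMap α ε).continuous
  have hs : ∀ i, ContDiff ℝ 1 (side i) := fun i => (contDiff_side i).of_le (by simp)
  rw [perturbedBdry, squareBdry, integral_finsetSum_measure fun i _ =>
      (compactlyCarried_arcMeasure (contDiff_hMap_side i)).integrable hF,
    integral_finsetSum_measure fun i _ =>
      (compactlyCarried_arcMeasure (hs i)).integrable hFh, ← Finset.sum_sub_distrib,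
    Finset.mul_sum]
  refine (Finset.abs_sum_le_sum_abs _ _).trans (Finset.sum_le_sum fun i _ => ?_)
  simp_rw [integral_arcMeasure (contDiff_hMap_side i) hF, integral_arcMeasure (hs i) hFh,
    norm_deriv_side, one_mul, intervalIntegral.integral_of_le zero_le_one]
  have c1 : Continuous fun s => F (hMap α ε (side i s)) := hFh.comp (hs i).continuous
  have c2 : Continuous fun s => ‖deriv (hMap α ε ∘ side i) s‖ * F ((hMap α ε ∘ side i) s) :=
    ((contDiff_hMap_side i).continuous_deriv le_rfl).norm.mul c1
  refine abs_integral_sub_le (c1.integrableOn_Ioc) (c2.integrableOn_Ioc)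
    (Eventually.of_forall fun s => ?_)
  rw [mul_comm]
  exact abs_mul_sub_le (hF0 _) (h.abs_norm_deriv_sub_one_le i s)

/-! ### Equilibria on the perturbed domain -/

/-- Only smooth functions are transported: `φ ∘ h_ε` is smooth on the whole plane, so coercivity on
the square applies to it. The limit is then taken on the perturbed domain, and no weak derivative is
ever composed with `h_ε`. -/
theorem perturbed_coercive (h : IsSmall α ε η) {c b d B δ : ℝ} (hc : 0 < c)
    (hco : ∀ u G w, H1Approx square squareBdry u G w →
      c * ((∫ x in square, ‖G x‖ ^ 2) + (∫ x in square, u x ^ 2) + ∫ x, w x ^ 2 ∂squareBdry)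
        ≤ (∫ x in square, ‖G x‖ ^ 2) + b * (∫ x in square, u x ^ 2)
          - d * ∫ x, w x ^ 2 ∂squareBdry)
    (hB : B ≤ d) (hδ : δ ≤ c / 4) (hη : (10 + |b - δ| + |B|) * η ≤ c / 4)
    {v w : Plane → ℝ} {G : Plane → Plane}
    (hv : H1Approx (perturbedDomain α ε) (perturbedBdry α ε) v G w) :
    c / 4 * ((∫ y in perturbedDomain α ε, ‖G y‖ ^ 2) + ∫ y in perturbedDomain α ε, v y ^ 2)
      ≤ (∫ y in perturbedDomain α ε, ‖G y‖ ^ 2)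
        + (b - δ) * (∫ y in perturbedDomain α ε, v y ^ 2)
        - B * ∫ y, w y ^ 2 ∂(perturbedBdry α ε) := by
  obtain ⟨φ, hφ, t1, t2, t3⟩ := hv.exists_seq
  have hcc := compactlyCarried_restrict h.isBounded_perturbedDomain
  have hcs := compactlyCarried_restrict isBounded_square
  have hσ : CompactlyCarried (perturbedBdry α ε) := compactlyCarried_perturbedBdry
  have l1 := tendsto_integral_norm_sq (fun n => hcc.memLp (hφ n).continuous 2) hv.memLp t1
  have l2 := tendsto_integral_norm_sq (fun n => hcc.memLp (continuous_gradient (hφ n)) 2)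
    hv.memLp_grad t2
  have l3 := tendsto_integral_norm_sq (fun n => hσ.memLp (hφ n).continuous 2) hv.memLp_trace t3
  simp only [Real.norm_eq_abs, sq_abs] at l1 l3
  refine le_of_tendsto_of_tendsto' ((l2.add l1).const_mul (c / 4))
    ((l2.add (l1.const_mul _)).sub (l3.const_mul _)) fun n => ?_
  have hΦ : ContDiff ℝ ∞ (φ n ∘ hMap α ε) := (hφ n).comp (contDiff_hMap α ε)
  have hap := H1Approx.of_contDiff isBounded_square compactlyCarried_squareBdry hΦ
  have cj := (contDiff_jac α ε).continuous
  have ch := (contDiff_hMap α ε).continuous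
  refine (coercive_of_close (by positivity) (by positivity) (by positivity)
    hc.le (hco _ _ _ hap) hB hδ h.eta_pos.le h.eta_le hη ?_ ?_ ?_).2
  · rw [h.integral_perturbedDomain]
    exact abs_integral_sub_le (hcs.integrable ((continuous_gradient hΦ).norm.pow 2))
      (hcs.integrable ((((continuous_gradient (hφ n)).comp ch).norm.pow 2).mul cj))
      ((ae_restrict_iff' isOpen_square.measurableSet).2
        (Eventually.of_forall fun x hx => h.abs_norm_gradient_sub_le (hφ n) hx))
  · rw [h.integral_perturbedDomain]
    exact abs_integral_sub_le (hcs.integrable (hΦ.continuous.pow 2))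
      (hcs.integrable ((hΦ.continuous.pow 2).mul cj))
      (Eventually.of_forall fun x => abs_mul_sub_le (sq_nonneg _) (h.abs_jac_sub_one_le x))
  · exact h.abs_integral_perturbedBdry_sub_le ((hφ n).continuous.pow 2) fun x => sq_nonneg _

/-- Bounds the constants of the energy estimate independently of `ε`. -/
theorem measureReal_perturbed_le (h : IsSmall α ε η) :
    (volume.restrict (perturbedDomain α ε)).real Set.univ
        ≤ 2 * (volume.restrict square).real Set.univ ∧
      (perturbedBdry α ε).real Set.univ ≤ 2 * squareBdry.real Set.univ := by
  have hcs := compactlyCarried_restrict isBounded_square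
  have fin := hcs.finite
  constructor
  · have := h.integral_perturbedDomain fun _ => 1
    rw [integral_const, smul_eq_mul, mul_one] at this
    rw [this]
    have h2 : 2 * (volume.restrict square).real Set.univ = ∫ x in square, (2 : ℝ) := by
      rw [integral_const, smul_eq_mul, mul_comm]
    rw [h2]
    exact integral_mono
      (hcs.integrable (continuous_const.mul (contDiff_jac α ε).continuous))
      (integrable_const _) fun x => by
        have := (h.jac_bounds x).2
        change 1 * jac α ε x ≤ 2
        linarith
  · have := (abs_le.1 (h.abs_integral_perturbedBdry_sub_le (F := fun _ => 1) continuous_const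
      fun _ => zero_le_one)).2
    simp only [integral_const, smul_eq_mul, mul_one] at this
    have h2 : η * squareBdry.real Set.univ ≤ 1 * squareBdry.real Set.univ :=
      mul_le_mul_of_nonneg_right (by linarith [h.eta_le]) measureReal_nonneg
    linarith

theorem perturbedEquilibria_bound {a : ℝ} (h : IsSmall α ε η) {f g : ℝ → ℝ}
    (hf : Continuous f) (hg : Continuous g) {A B C D c c₀ d₀ δ : ℝ}
    (hC : 0 ≤ C) (hD : 0 ≤ D)
    (hfA : ∀ s, f s * s ≤ A * s ^ 2 + C) (hgB : ∀ s, g s * s ≤ B * s ^ 2 + D) (hc : 0 < c)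
    (hco : ∀ u G w, H1Approx square squareBdry u G w →
      c * ((∫ x in square, ‖G x‖ ^ 2) + (∫ x in square, u x ^ 2) + ∫ x, w x ^ 2 ∂squareBdry)
        ≤ (∫ x in square, ‖G x‖ ^ 2) + (a - c₀) * (∫ x in square, u x ^ 2)
          - d₀ * ∫ x, w x ^ 2 ∂squareBdry)
    (hA : A = c₀ + δ) (hB : B ≤ d₀) (hδ : δ ≤ c / 4)
    (hη : (10 + |a - c₀ - δ| + |B|) * η ≤ c / 4) {v : Plane → ℝ}
    (hv : v ∈ perturbedEquilibria α ε a f g) :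
    c / 4 * h1Norm (perturbedDomain α ε) v ^ 2
      ≤ C * 2 * (volume.restrict square).real Set.univ + D * 2 * squareBdry.real Set.univ := by
  obtain ⟨hv1, w, hw, heq⟩ := hv
  have hΩ := h.isOpen_perturbedDomain
  have hb := h.isBounded_perturbedDomain
  have hσ : CompactlyCarried (perturbedBdry α ε) := compactlyCarried_perturbedBdry
  have hap := hw.h1Approx hΩ hb
  have fin1 := (compactlyCarried_restrict hb).finite
  have fin2 := hσ.finite
  obtain ⟨K, hK0, hK, -⟩ := exists_bound_deriv_logTrunc
  have energy := energy_le (a := a) (j := fun _ => 1) (k := fun _ => 1) (M := 1) hap.memLp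
    hap.memLp_trace (hap.memLp_grad.integrable_norm_pow (by norm_num))
    (Eventually.of_forall fun x => sq_nonneg ‖weakGrad (perturbedDomain α ε) v x‖)
    aestronglyMeasurable_const (by simp) aestronglyMeasurable_const (by simp)
    hf hg hC hD hfA hgB (fun n => by
      have hcp := hap.comp hb hσ (contDiff_logTrunc n) (hK n)
      have := heq _ _ (hcp.memH1 hb) (hcp.isTrace hΩ hb)
      simp only [Function.comp, mul_one] at this ⊢
      rw [← this]
      congr 1
      refine integral_congr_ae ?_
      filter_upwards [hcp.weakGrad_ae_eq hΩ hb] with x hx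
      rw [hx, real_inner_smul_right, real_inner_self_eq_norm_sq])
  have close := h.perturbed_coercive hc hco hB hδ hη hap
  obtain ⟨m1, m2⟩ := h.measureReal_perturbed_le
  simp only [mul_one] at energy
  rw [hA, ← sub_sub] at energy
  rw [h1Norm, Real.sq_sqrt (by positivity), add_comm (∫ x in perturbedDomain α ε, v x ^ 2)]
  nlinarith [mul_le_mul_of_nonneg_left m1 hC, mul_le_mul_of_nonneg_left m2 hD]

end IsSmall

end OscillatingSquare
end

/-! ### The uniform bound for both families of equilibria -/

theorem mainTheorem12 (α a : ℝ) (hα₀ : 0 < α) (hα₁ : α < 1) (ha : 0 < a)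
    (f g : ℝ → ℝ) (hf : ContDiff ℝ 1 f) (hg : ContDiff ℝ 2 g)
    (lam₁ L₁ lam₂ L₂ : ℝ)
    (hfgrowth : OscillatingSquare.Growth f lam₁ L₁)
    (hggrowth : OscillatingSquare.Growth g lam₂ L₂)
    (c₀ d₀ d₀' : ℝ)
    (hfdiss : OscillatingSquare.LimsupQuotientLE f c₀)
    (hgdiss : OscillatingSquare.LimsupQuotientLE g d₀')
    (hd : d₀' < d₀)
    (μ₁ : ℝ)
    (hμ₁ : IsLeast {μ : ℝ | OscillatingSquare.IsRobinEigenvalue a c₀ d₀ μ} μ₁)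
    (hμ₁pos : 0 < μ₁) :
    ∃ ε₀ : ℝ, 0 < ε₀ ∧ ∃ R : ℝ, ∀ ε : ℝ, 0 < ε → ε < ε₀ →
      (∀ v ∈ OscillatingSquare.perturbedEquilibria α ε a f g,
        OscillatingSquare.h1Norm (OscillatingSquare.perturbedDomain α ε) v ≤ R) ∧
      (∀ u ∈ OscillatingSquare.equilibria α ε a f g,
        OscillatingSquare.h1Norm OscillatingSquare.square u ≤ R) := by
  open OscillatingSquare MeasureTheory in
  obtain ⟨c, hc, hco⟩ := exists_coercive hμ₁ hμ₁pos
  -- The slack above `c₀` is the `δ = c / 4` allowed by `coercive_of_close`. For `g` the gap `d₀' <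
  -- d₀` permits `B = d₀`.
  obtain ⟨C, hC, hfA⟩ := exists_mul_self_le hf.continuous hfdiss
    (show c₀ < c₀ + c / 4 by linarith)
  obtain ⟨D, hD, hgB⟩ := exists_mul_self_le hg.continuous hgdiss hd
  have hk : 0 < 10 + |a - c₀ - c / 4| + |d₀| := by positivity
  -- This `η` makes the coefficient errors at most `c / 4`.
  obtain ⟨ε₀, hε₀, hsmall⟩ := exists_isSmall
    (η := min (1 / 10) (c / 4 / (10 + |a - c₀ - c / 4| + |d₀|))) hα₁ (by positivity)
    (min_le_left _ _)
  have hη : (10 + |a - c₀ - c / 4| + |d₀|)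
      * min (1 / 10) (c / 4 / (10 + |a - c₀ - c / 4| + |d₀|)) ≤ c / 4 := by
    have := mul_le_mul_of_nonneg_left
      (min_le_right (1 / 10) (c / 4 / (10 + |a - c₀ - c / 4| + |d₀|))) hk.le
    rwa [mul_div_cancel₀ _ hk.ne'] at this
  set T := C * 2 * (volume.restrict square).real Set.univ + D * 2 * squareBdry.real Set.univ
  -- The radius comes from the weaker bound `c / 4 * ‖v‖² ≤ T`, the one on the perturbed domain.
  refine ⟨ε₀, hε₀, Real.sqrt (4 / c * T), fun ε h0 hlt => ⟨fun v hv => ?_, fun u hu => ?_⟩⟩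
  · have h := (hsmall ε h0 hlt).perturbedEquilibria_bound hf.continuous hg.continuous hC hD
      hfA hgB hc hco rfl le_rfl le_rfl hη hv
    refine Real.le_sqrt_of_sq_le ?_
    rw [div_mul_eq_mul_div, le_div_iff₀ hc]
    linarith
  · have h := (hsmall ε h0 hlt).equilibria_bound hf.continuous hg.continuous hC hD
      hfA hgB hc hco rfl le_rfl le_rfl hη hu
    refine Real.le_sqrt_of_sq_le ?_
    rw [div_mul_eq_mul_div, le_div_iff₀ hc]
    nlinarith [mul_nonneg hc.le (sq_nonneg (h1Norm square u))]
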